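/- **Setting.** Let $Y=(Y_n)_{n\ge1}$ be an irreducible aperiodic Markov chain on $S=\{1,\dots,K\}$ with transition matrix $(p_{ij})$ and stationary initial distribution $\pi$. Let $X_n=h(Y_n,e_n)$ be a hidden Markov model ($h$ measurable, $e_1,e_2,\dots$ i.i.d. and independent of $Y$), where $h(l,e_n)$ has density $f_l$ with respect to a dominating measure $\lambda$. For a distribution $\iota$ on $S$ put $\Lambda_\iota(v;x_{1\dots n})=\iota_{v_1}f_{v_1}(x_1)\prod_{i=2}^n p_{v_{i-1}v_i}f_{v_i}(x_i)$. Let $\mathcal W^{l}(x_{1\dots n})$ and $\mathcal W_{(l)}^{l}(x_{1\dots n})$ be the sets of maximizers of $\Lambda_\pi$ and of $\Lambda_{(p_{lj})_j}$, respectively, over all $v\in S^n$ with $v_n=l$, and let $\vee W$ denote the maximum of $W\subset S^n$ in the reverse lexicographic order. **Nodes and barriers.** Let $\delta_u(i)=\max\{\Lambda_\pi(v;x_{1\dots u}):v\in S^u,\ v_u=i\}$ and $p^{(r)}_{ij}(u)=\max_{q_1,\dots,q_r}p_{iq_1}f_{q_1}(x_{u+1})p_{q_1q_2}\cdots f_{q_r}(x_{u+r})p_{q_rj}$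 (with $p^{(0)}_{ij}=p_{ij}$). The observation $x_u$ is an $l$-node of order $r$ if $\delta_u(l)p^{(r)}_{lj}(u)\ge\delta_u(i)p^{(r)}_{ij}(u)$ for all $i,j\in S$. A block $b\in\mathcal X^M$ is an $l$-barrier of order $r$ if for every $w>0$ and $x'\in\mathcal X^w$ the $(w+M-r)$-th element of $(x',b)$ is an $l$-node of order $r$. **Barrier set and path.** Let $0\le r<M$, $l\in S$, let $B=B_1\times\dots\times B_M\subset\mathcal X^M$ with each $B_i$ measurable be a set of $l$-barriers of order $r$, and let $q=(q_1,\dots,q_M)\in S^M$ satisfy $q_{M-r}=l$, $\mathbf P(Y_{1\dots M}=q)>0$ and $\mathbf P(X_{1\dots M}\in B\mid Y_{1\dots M}=q)>0$. Assume that the barriers are separated: for every $w$ with $1\le w\le\max(r,\,M-1-r)$ and every $b\in B$, no block of the form $(x'_1,\dots,x'_w,b_1,\dots,b_{M-w})$ belongs to $B$. **Times and alignment.** Let $\nu_0<\nu_1<\cdots$ be the successive $n\ge1$ with $(X_n,\dots,X_{n+M-1})\in B$ and $(Y_n,\dots,Y_{n+M-1})=q$, and let $\tau_i=\nu_i+M-1-r$.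 Let $\vartheta_0<\vartheta_1<\cdots$ be the successive $n\ge1$ with $(X_n,\dots,X_{n+M-1})\in B$, and let $u_i=\vartheta_i+M-1-r$. The infinite alignment $v(X)$ is the concatenation of $\vee\mathcal W^{l}(X_{1\dots u_0}),\ \vee\mathcal W_{(l)}^{l}(X_{u_0+1\dots u_1}),\ \vee\mathcal W_{(l)}^{l}(X_{u_1+1\dots u_2}),\dots$, continued by $1,1,\dots$ if there are only finitely many $u_i$. Put $V=v(X)$ and $Z=(X,V)$. **Proposition.** Almost surely all $\tau_i$ are defined (there are infinitely many $\nu_i$), and up to null sets each $\tau_i+r$ is a stopping time of the filtration $\sigma(Y_1,\dots,Y_n,X_1,\dots,X_n)$, $n\ge 0$. Each of the processes $W=X$, $W=V$, $W=Z$ is regenerative with respect to $(\tau_i)_{i\ge0}$: for every $i$, the post-$\tau_i$ process $(W_{\tau_i+n})_{n\ge1}$ together with $(\tau_{i+j}-\tau_i)_{j\ge1}$ is independent of $(W_1,\dots,W_{\tau_i})$ together with $(\tau_0,\dots,\tau_i)$, and its law does not depend on $i$. Moreover, there are measurable maps $g_n:\mathcal X^n\to S^n$, $n\ge 0$, such that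 almost surely $(V_{\tau_{i-1}+1},\dots,V_{\tau_i})=g_{\tau_i-\tau_{i-1}}(X_{\tau_{i-1}+1},\dots,X_{\tau_i})$ for all $i\ge1$. -/

import Mathlib

open MeasureTheory ProbabilityTheory

noncomputable section

/-! Time is indexed from `0` for processes and observation sequences: the value at index `n`
is the observation counted as number `n + 1`.  A time `u` (a node time, a regeneration time) is
the *number* of observations up to and including that instant, so that the observations
`x_1, ..., x_u` are `x 0, ..., x (u - 1)` and `x_{u+1}` is `x u`. -/

/-- Parameters of a hidden Markov model with `K` states `Fin K`: an irreducible aperiodic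
transition matrix `p`, its stationary initial distribution `init`, and emission densities `f l`
with respect to the dominating measure `dom`. -/
structure HMMModel (K : ℕ) (𝒳 : Type*) [MeasurableSpace 𝒳] where
  p : Matrix (Fin K) (Fin K) ℝ
  init : Fin K → ℝ
  f : Fin K → 𝒳 → ℝ
  dom : Measure 𝒳
  p_stochastic : p ∈ Matrix.rowStochastic ℝ (Fin K)
  p_irreducible : p.IsIrreducible
  p_aperiodic : ∀ i : Fin K, ∀ d : ℕ, (∀ n : ℕ, 1 ≤ n → 0 < (p ^ n) i i → d ∣ n) → d = 1
  init_nonneg : ∀ i, 0 ≤ init i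
  init_sum : ∑ i, init i = 1
  init_stationary : ∀ j, ∑ i, init i * p i j = init j
  f_nonneg : ∀ l x, 0 ≤ f l x
  f_measurable : ∀ l, Measurable (f l)
  f_prob : ∀ l, ∫⁻ x, ENNReal.ofReal (f l x) ∂dom = 1

/-- `X` is a hidden Markov model with parameters `m`: `Y` is a Markov chain with initial
distribution `m.init` and transition matrix `m.p`, and `X n = h (Y n, e n)` with `e` i.i.d. and
independent of `Y`, where `h (l, e n)` has density `m.f l`. -/
structure IsHMM {K : ℕ} {𝒳 Ω 𝓔 : Type*} [MeasurableSpace 𝒳] [MeasurableSpace Ω]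
    [MeasurableSpace 𝓔] (m : HMMModel K 𝒳) (P : Measure Ω) (Y : ℕ → Ω → Fin K)
    (e : ℕ → Ω → 𝓔) (h : Fin K × 𝓔 → 𝒳) (X : ℕ → Ω → 𝒳) : Prop where
  measurable_Y : ∀ n, Measurable (Y n)
  measurable_e : ∀ n, Measurable (e n)
  measurable_h : Measurable h
  chain : ∀ (n : ℕ) (s : Fin (n + 1) → Fin K),
    P {ω | ∀ j : Fin (n + 1), Y j ω = s j} =
      ENNReal.ofReal (m.init (s 0) * ∏ j : Fin n, m.p (s j.castSucc) (s j.succ))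
  e_indep : iIndepFun e P
  e_ident : ∀ n, IdentDistrib (e n) (e 0) P P
  e_indep_Y : IndepFun (fun ω n => Y n ω) (fun ω n => e n ω) P
  emission : ∀ l n, P.map (fun ω => h (l, e n ω)) =
    m.dom.withDensity (fun x => ENNReal.ofReal (m.f l x))
  obs : ∀ n ω, X n ω = h (Y n ω, e n ω)

namespace HMMModel

variable {K : ℕ} {𝒳 : Type*} [MeasurableSpace 𝒳] (m : HMMModel K 𝒳)

/-- The likelihood `Λ(v; x)` of the state path `v` of length `n`, computed with the initial
distribution `ι`. -/
def likelihood (ι : Fin K → ℝ) {n : ℕ} (x : Fin n → 𝒳) (v : Fin n → Fin K) : ℝ :=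
  (∏ j : Fin n, if (j : ℕ) = 0 then ι (v j)
      else m.p (v ⟨(j : ℕ) - 1, lt_of_le_of_lt (Nat.sub_le _ _) j.isLt⟩) (v j)) *
    ∏ j : Fin n, m.f (v j) (x j)

/-- The last state of the path `v` is `l`. -/
def EndsAt {n : ℕ} (l : Fin K) (v : Fin n → Fin K) : Prop :=
  ∀ j : Fin n, (j : ℕ) + 1 = n → v j = l

/-- The set of maximizers of the likelihood, with initial distribution `ι`, among the paths of
length `n` with last state `l`. -/
def constrainedAlignments (ι : Fin K → ℝ) (l : Fin K) {n : ℕ} (x : Fin n → 𝒳) :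
    Set (Fin n → Fin K) :=
  {v | EndsAt l v ∧ ∀ w, EndsAt l w → m.likelihood ι x w ≤ m.likelihood ι x v}

/-- The score `δ_u(l)`: the maximal likelihood of `x_1, ..., x_u` over the paths of length `u` with
last state `l`. -/
def score (x : ℕ → 𝒳) (u : ℕ) (l : Fin K) : ℝ :=
  ⨆ v : {v : Fin u → Fin K // EndsAt l v}, m.likelihood m.init (fun j : Fin u => x j) v.1

/-- The maximal partial likelihood `p^{(r)}_{ij}(u)`: the maximum over `q_1, ..., q_r` of
`p_{i q_1} f_{q_1}(x_{u+1}) p_{q_1 q_2} ... f_{q_r}(x_{u+r}) p_{q_r j}`; it is `p_{ij}` for `r = 0`.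
The variable `s` is the path `(i, q_1, ..., q_r, j)`. -/
def partialLikelihood (x : ℕ → 𝒳) (r u : ℕ) (i j : Fin K) : ℝ :=
  ⨆ s : {s : Fin (r + 2) → Fin K // s 0 = i ∧ s (Fin.last (r + 1)) = j},
    (∏ k : Fin (r + 1), m.p (s.1 k.castSucc) (s.1 k.succ)) *
      ∏ k : Fin r, m.f (s.1 k.succ.castSucc) (x (u + k))

/-- The observation `x_u` is an `l`-node of order `r`; this depends on `x_1, ..., x_{u+r}` only. -/
def IsNode (x : ℕ → 𝒳) (r u : ℕ) (l : Fin K) : Prop :=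
  ∀ i j : Fin K, m.score x u i * m.partialLikelihood x r u i j ≤
    m.score x u l * m.partialLikelihood x r u l j

/-- The block `b` is an `l`-barrier of order `r` and length `M`: whichever `w > 0` observations
precede it, the observation number `w + M - r` is an `l`-node of order `r`. -/
def IsBarrier (r : ℕ) (l : Fin K) {M : ℕ} (b : Fin M → 𝒳) : Prop :=
  ∀ w : ℕ, 0 < w → ∀ x : ℕ → 𝒳, (∀ j : Fin M, x (w + j) = b j) → m.IsNode x r (w + M - r) l

end HMMModel

/-- No block of `B` is of the form `(x'_1, ..., x'_w, b_1, ..., b_{M-w})` with `b ∈ B`. -/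
def NoOverlapAt {𝒳 : Type*} {M : ℕ} (B : Set (Fin M → 𝒳)) (w : ℕ) : Prop :=
  ∀ b ∈ B, ∀ y : Fin M → 𝒳,
    (∀ (j : Fin M) (hj : w + (j : ℕ) < M), y ⟨w + j, hj⟩ = b j) → y ∉ B

/-- All blocks of `B`, barriers of order `r`, are separated relative to `B`. -/
def IsSeparated {𝒳 : Type*} {M : ℕ} (B : Set (Fin M → 𝒳)) (r : ℕ) : Prop :=
  ∀ w, 1 ≤ w → w ≤ r → NoOverlapAt B w

/-- Reverse lexicographic order on paths: `a ≺ b`. -/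
def RevLexLT {K n : ℕ} (a b : Fin n → Fin K) : Prop :=
  ∃ i, a i < b i ∧ ∀ j, i < j → a j = b j

open Classical in
/-- The element `∨ W` selected from `W`: its maximum in the reverse lexicographic order
(a constant path if `W` has no maximum, that is, if `W` is empty). -/
def revLexMax {K n : ℕ} [NeZero K] (W : Set (Fin n → Fin K)) : Fin n → Fin K :=
  if h : ∃ v ∈ W, ∀ w ∈ W, w = v ∨ RevLexLT w v then h.choose else fun _ => 0

/-- The number `u` is one of the node times `u_0 < u_1 < ...` read off from `x`: a block of `x` lying
in `B` starts right after the first `k` observations, and `u = k + M - r` is the location of the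
node of order `r` in that block. -/
def IsNodeTime {𝒳 : Type*} {M : ℕ} (B : Set (Fin M → 𝒳)) (r : ℕ) (x : ℕ → 𝒳) (u : ℕ) : Prop :=
  ∃ k, u = k + (M - r) ∧ (fun j : Fin M => x (k + j)) ∈ B

open Classical in
/-- The infinite proper piecewise alignment `v(x_1, x_2, ...)`.  With `u_0 < u_1 < ...` the node
times of `x`, it is the concatenation of the selected maximizers `∨ W^l(x_1, ..., x_{u_0})` (initial
distribution `m.init`) and `∨ W_{(l)}^l(x_{u_{i-1}+1}, ..., x_{u_i})` (initial distribution
`(p_{lj})_j`).  After the last node time, if there is one, it is the first state.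
Here `a` is the last node time `≤ n` (`0` if there is none) and `b` is the first one `> n`. -/
def HMMModel.infiniteAlignment {K M : ℕ} [NeZero K] {𝒳 : Type*} [MeasurableSpace 𝒳]
    (m : HMMModel K 𝒳) (B : Set (Fin M → 𝒳)) (r : ℕ) (l : Fin K) (x : ℕ → 𝒳) (n : ℕ) : Fin K :=
  if h : ∃ b, n < b ∧ IsNodeTime B r x b then
    let b := Nat.find h
    let a := Nat.findGreatest (fun u => 0 < u ∧ IsNodeTime B r x u) n
    revLexMax (m.constrainedAlignments (if a = 0 then m.init else m.p l) l
        (fun j : Fin (b - a) => x (a + j)))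
      ⟨n - a, Nat.sub_lt_sub_right (Nat.findGreatest_le n) (Nat.find_spec h).1⟩
  else 0

/-- The regeneration time `τ_i`: the node time of the `i`-th (counted from `0`) block of
observations that lies in `B` and is emitted along the state path `q`.  (If there are not that many
such blocks, which has probability `0`, then `Nat.nth` is `0`.) -/
def regenerationTime {K M : ℕ} {𝒳 Ω : Type*} (B : Set (Fin M → 𝒳)) (r : ℕ) (q : Fin M → Fin K)
    (X : ℕ → Ω → 𝒳) (Y : ℕ → Ω → Fin K) (i : ℕ) (ω : Ω) : ℕ :=
  Nat.nth (fun k => (fun j : Fin M => X (k + j) ω) ∈ B ∧ (fun j : Fin M => Y (k + j) ω) = q) i +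
    (M - r)

/-- The process `W` is regenerative with respect to the (delayed renewal) sequence of random times
`τ 0 < τ 1 < ...`: for each `i`, the process after `τ i`, jointly with the future times counted from
`τ i`, is independent of the process up to `τ i`, jointly with `τ 0, ..., τ i`, and its law does not
depend on `i`.  Since `W 0, ..., W (t - 1)` are the first `t` values, the process up to `τ i` is
coded by `W` frozen at index `τ i - 1`. -/
structure IsRegenerative {Ω E : Type*} [MeasurableSpace Ω] [MeasurableSpace E] (P : Measure Ω)
    (W : ℕ → Ω → E) (τ : ℕ → Ω → ℕ) : Prop where
  increasing : ∀ᵐ ω ∂P, 0 < τ 0 ω ∧ ∀ i, τ i ω < τ (i + 1) ω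
  indep : ∀ i : ℕ, IndepFun
    (fun ω => ((fun j : Fin (i + 1) => τ j ω), (fun n : ℕ => W (min n (τ i ω - 1)) ω)))
    (fun ω => ((fun j : ℕ => τ (i + 1 + j) ω - τ i ω), (fun n : ℕ => W (τ i ω + n) ω))) P
  ident : ∀ i : ℕ, IdentDistrib
    (fun ω => ((fun j : ℕ => τ (i + 1 + j) ω - τ i ω), (fun n : ℕ => W (τ i ω + n) ω)))
    (fun ω => ((fun j : ℕ => τ (0 + 1 + j) ω - τ 0 ω), (fun n : ℕ => W (τ 0 ω + n) ω))) P P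

end

/-!
The observations and the hidden states form a Markov process `(Y_n, X_n)` whose future after time
`n` depends on the past through `Y_n` only, and node times are the instants at which the alignment
starts afresh.

* **Markov property.** The states and the noise are independent, the noise is i.i.d., and the chain
  has the Markov property (`IsHMM.chain_markov`). Hence, on `Y_t = i`, the pairs after time `t` are
  independent of the pairs up to time `t`, with a law depending on `i` only
  (`IsHMM.pair_markov`, `IsHMM.measure_past_inter_future`).
* **Recurrence.** By irreducibility, from every state a barrier emitted along `q` begins within a
  bounded time with probability bounded away from `0`. The probability of seeing none in `k`
  successive windows decays geometrically, so almost surely there are infinitely many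
  (`IsHMM.ae_infinite_isGood`).
* **Separation.** If the node of the `i`-th such barrier is at `t`, the state at `t` is `l`, the last
  `r` elements of the barrier lie after `t`, all earlier blocks in `B` end before `t`, and all later
  ones begin after `t`. So the event `τ_i = t` is the intersection of an event of the first `t` pairs
  and an event of the pairs after `t` that depends neither on `i` nor on `t`
  (`nth_isGood_eq_iff`). On that event, the regeneration times, the observations and the alignment
  up to `t` are functions of the first `t` pairs (`pastData_freeze`), and those after `t` are a fixed
  function of the pairs after `t` (`futureData_shift`): the alignment restarts at `t` with initial
  distribution `m.p l` (`alignment_shift`, `alignment_congr`).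
* **Conclusion.** The Markov property at time `t`, summed over `t`, gives independence and a law of
  the future that does not depend on `i` (`indep_of_factor_on_times`). The statements for the
  observations and for the alignment alone are projections of the one for the pair.
-/

noncomputable section

/-! ### Frozen and shifted sequences -/

/-- The sequence `z` stopped after its first `t` values: it records `z 0, ..., z (t - 1)` and then
repeats the last of them. -/
def freeze {E : Type*} (t : ℕ) (z : ℕ → E) : ℕ → E := fun n => z (min n (t - 1))

/-- The sequence `z` with its first `t` values removed. -/
def shift {E : Type*} (t : ℕ) (z : ℕ → E) : ℕ → E := fun n => z (t + n)

theorem freeze_apply_of_lt {E : Type*} {t n : ℕ} (z : ℕ → E) (hn : n < t) :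
    freeze t z n = z n := by
  unfold freeze
  rw [min_eq_left (by omega)]

theorem freeze_eq_freeze {E : Type*} {t : ℕ} (ht : 0 < t) {z w : ℕ → E}
    (h : ∀ n < t, z n = w n) : freeze t z = freeze t w :=
  funext fun n => h _ (by omega)

theorem measurable_freeze {E : Type*} [MeasurableSpace E] (t : ℕ) :
    Measurable (freeze (E := E) t) :=
  measurable_pi_lambda _ fun _ => measurable_pi_apply _

theorem measurable_shift {E : Type*} [MeasurableSpace E] (t : ℕ) :
    Measurable (shift (E := E) t) :=
  measurable_pi_lambda _ fun _ => measurable_pi_apply _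

/-! ### Sequences in a finite alphabet -/

/-- The set of sequences that agree with `w` in the first `n` values. -/
def seqCylinder {A : Type*} (n : ℕ) (w : ℕ → A) : Set (ℕ → A) := {y | ∀ j < n, y j = w j}

section FiniteAlphabet

variable {A : Type*}

theorem isPiSystem_seqCylinder : IsPiSystem {s : Set (ℕ → A) | ∃ n w, s = seqCylinder n w} := by
  rintro _ ⟨n, w, rfl⟩ _ ⟨n', w', rfl⟩ ⟨z, hz, hz'⟩
  refine ⟨max n n', z, ?_⟩
  ext y
  refine ⟨fun ⟨h, h'⟩ j hj => ?_, fun h => ⟨fun j hj => ?_, fun j hj => ?_⟩⟩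
  · rcases lt_max_iff.1 hj with hj | hj
    · rw [h j hj, hz j hj]
    · rw [h' j hj, hz' j hj]
  · rw [h j (lt_max_of_lt_left hj), hz j hj]
  · rw [h j (lt_max_of_lt_right hj), hz' j hj]

variable [MeasurableSpace A] [MeasurableSingletonClass A]

theorem measurableSet_seqCylinder (n : ℕ) (w : ℕ → A) : MeasurableSet (seqCylinder n w) := by
  have : seqCylinder n w = ⋂ j, ⋂ (_ : j < n), (fun y : ℕ → A => y j) ⁻¹' {w j} := by
    ext y; simp [seqCylinder]
  rw [this]
  exact MeasurableSet.iInter fun j => MeasurableSet.iInter fun _ =>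
    measurable_pi_apply j (measurableSet_singleton _)

theorem generateFrom_seqCylinder [Finite A] :
    (MeasurableSpace.pi : MeasurableSpace (ℕ → A)) =
      MeasurableSpace.generateFrom {s : Set (ℕ → A) | ∃ n w, s = seqCylinder n w} := by
  refine le_antisymm (iSup_le fun n => ?_) (MeasurableSpace.generateFrom_le ?_)
  · rintro _ ⟨s, -, rfl⟩
    have : (fun y : ℕ → A => y n) ⁻¹' s =
        ⋃ w : Fin (n + 1) → A, ⋃ (_ : w (Fin.last n) ∈ s),
          seqCylinder (n + 1) (fun j => w ⟨min j n, by omega⟩) := by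
      ext y
      simp only [Set.mem_preimage, Set.mem_iUnion, seqCylinder, Set.mem_ofPred_eq, exists_prop]
      constructor
      · intro h
        refine ⟨fun j => y j, h, fun j hj => ?_⟩
        simp [min_eq_left (Nat.lt_succ_iff.1 hj)]
      · rintro ⟨w, hw, h⟩
        rw [h n (Nat.lt_succ_self n)]
        simpa [Fin.last] using hw
    rw [this]
    exact MeasurableSet.iUnion fun w => MeasurableSet.iUnion fun _ =>
      MeasurableSpace.measurableSet_generateFrom ⟨_, _, rfl⟩
  · rintro _ ⟨n, w, rfl⟩
    exact measurableSet_seqCylinder n w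

theorem ext_of_seqCylinder [Finite A] {μ ν : Measure (ℕ → A)} [IsFiniteMeasure μ] [Nonempty A]
    (h : ∀ n w, μ (seqCylinder n w) = ν (seqCylinder n w)) : μ = ν := by
  refine ext_of_generate_finite _ generateFrom_seqCylinder isPiSystem_seqCylinder ?_ ?_
  · rintro _ ⟨n, w, rfl⟩
    exact h n w
  · obtain ⟨a⟩ := ‹Nonempty A›
    simpa [seqCylinder] using h 0 fun _ => a

end FiniteAlphabet

/-! ### The Markov property of the hidden chain -/

section Chain

variable {K : ℕ} {𝒳 Ω 𝓔 : Type*} [MeasurableSpace 𝒳] [MeasurableSpace Ω]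
  [MeasurableSpace 𝓔] {m : HMMModel K 𝒳} {P : Measure Ω}
  {Y : ℕ → Ω → Fin K} {e : ℕ → Ω → 𝓔} {h : Fin K × 𝓔 → 𝒳} {X : ℕ → Ω → 𝒳}

/-- The path of a process, as a random element of the sequence space. -/
def path {Ω E : Type*} (W : ℕ → Ω → E) (ω : Ω) : ℕ → E := fun n => W n ω

theorem measurable_path {E : Type*} [MeasurableSpace E] {W : ℕ → Ω → E}
    (hW : ∀ n, Measurable (W n)) : Measurable (path W) :=
  measurable_pi_lambda _ hW

/-- The chain law of `IsHMM`, with the prefix read off from a whole sequence of states. -/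
theorem IsHMM.prob_prefix (hX : IsHMM m P Y e h X) (n : ℕ) (s : ℕ → Fin K) :
    P (path Y ⁻¹' seqCylinder (n + 1) s) =
      ENNReal.ofReal (m.init (s 0) * ∏ j ∈ Finset.range n, m.p (s j) (s (j + 1))) := by
  have := hX.chain n (fun j => s j)
  rw [Finset.prod_range]
  convert! this using 2
  ext ω
  simp only [Set.mem_preimage, seqCylinder, path, Set.mem_ofPred_eq]
  exact ⟨fun hh j => hh j j.2, fun hh j hj => hh ⟨j, hj⟩⟩

theorem HMMModel.p_nonneg (m : HMMModel K 𝒳) (i j : Fin K) : 0 ≤ m.p i j :=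
  m.p_irreducible.1 i j

/-- The stationary distribution of an irreducible chain charges every state. -/
theorem HMMModel.init_pos (m : HMMModel K 𝒳) (j : Fin K) : 0 < m.init j := by
  have hpow : ∀ n j, ∑ i, m.init i * (m.p ^ n) i j = m.init j := by
    intro n
    induction n with
    | zero => intro j; simp [Matrix.one_apply]
    | succ n ih =>
      intro j
      simp only [pow_succ, Matrix.mul_apply, Finset.mul_sum]
      rw [Finset.sum_comm]
      simp only [← mul_assoc, ← Finset.sum_mul, ih]
      exact m.init_stationary j
  obtain ⟨i, -, hi⟩ : ∃ i ∈ Finset.univ, m.init i ≠ 0 := by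
    refine Finset.exists_ne_zero_of_sum_ne_zero ?_
    rw [m.init_sum]; exact one_ne_zero
  obtain ⟨n, -, hn⟩ := (Matrix.isIrreducible_iff_exists_pow_pos m.p_nonneg).1 m.p_irreducible i j
  rw [← hpow n j]
  exact Finset.sum_pos' (fun i _ => mul_nonneg (m.init_nonneg i) (Matrix.pow_apply_nonneg m.p_nonneg n i j))
    ⟨i, Finset.mem_univ _, mul_pos (lt_of_le_of_ne (m.init_nonneg i) (Ne.symm hi)) hn⟩

/-- The law of `(Y_1, Y_2, ...)` given `Y_0 = i`. -/
def chainKernel (P : Measure Ω) (Y : ℕ → Ω → Fin K) (i : Fin K) : Measure (ℕ → Fin K) :=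
  (P[|Y 0 ⁻¹' {i}]).map (fun ω => shift 1 (path Y ω))

theorem IsHMM.prob_start (hX : IsHMM m P Y e h X) (i : Fin K) :
    P (Y 0 ⁻¹' {i}) = ENNReal.ofReal (m.init i) := by
  have := hX.prob_prefix 0 (fun _ => i)
  rw [Finset.range_zero, Finset.prod_empty, mul_one] at this
  rw [← this]
  congr 1
  ext ω
  simp [seqCylinder, path]

theorem IsHMM.isProbabilityMeasure_chainKernel [IsFiniteMeasure P] (hX : IsHMM m P Y e h X) (i : Fin K) :
    IsProbabilityMeasure (chainKernel P Y i) := by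
  have : IsProbabilityMeasure (P[|Y 0 ⁻¹' {i}]) := by
    apply cond_isProbabilityMeasure
    rw [hX.prob_start]
    simpa using m.init_pos i
  exact Measure.isProbabilityMeasure_map
    ((measurable_shift 1).comp (measurable_path hX.measurable_Y)).aemeasurable

theorem IsHMM.chainKernel_apply [IsFiniteMeasure P] (hX : IsHMM m P Y e h X) (i : Fin K) {F : Set (ℕ → Fin K)}
    (hF : MeasurableSet F) :
    P (Y 0 ⁻¹' {i}) * chainKernel P Y i F =
      P (Y 0 ⁻¹' {i} ∩ (fun ω => shift 1 (path Y ω)) ⁻¹' F) := by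
  have hs : MeasurableSet (Y 0 ⁻¹' {i}) := hX.measurable_Y 0 (measurableSet_singleton i)
  have hm : Measurable (fun ω => shift 1 (path Y ω)) :=
    (measurable_shift 1).comp (measurable_path hX.measurable_Y)
  rw [chainKernel, Measure.map_apply hm hF, mul_comm,
    cond_mul_eq_inter hs]

theorem IsHMM.chainKernel_seqCylinder [IsFiniteMeasure P] (hX : IsHMM m P Y e h X) (i : Fin K) (n : ℕ)
    (w : ℕ → Fin K) :
    chainKernel P Y i (seqCylinder (n + 1) w) =
      ENNReal.ofReal (m.p i (w 0) * ∏ j ∈ Finset.range n, m.p (w j) (w (j + 1))) := by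
  have h0 := hX.chainKernel_apply i (measurableSet_seqCylinder (n + 1) w)
  have h1 := hX.prob_prefix (n + 1) (fun j => if j = 0 then i else w (j - 1))
  have h2 : Y 0 ⁻¹' {i} ∩ (fun ω => shift 1 (path Y ω)) ⁻¹' seqCylinder (n + 1) w =
      path Y ⁻¹' seqCylinder (n + 1 + 1) (fun j => if j = 0 then i else w (j - 1)) := by
    ext ω
    simp only [Set.mem_inter_iff, Set.mem_preimage, Set.mem_singleton_iff, seqCylinder,
      Set.mem_ofPred_eq, shift, path]
    constructor
    · rintro ⟨h, h'⟩ j hj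
      split_ifs with hj0
      · rw [hj0]; exact h
      · have := h' (j - 1) (by omega)
        rwa [Nat.add_sub_cancel' (by omega)] at this
    · intro h
      refine ⟨h 0 (by omega), fun j hj => ?_⟩
      rw [h _ (by omega), if_neg (by omega), Nat.add_sub_cancel_left]
  rw [h2, h1, hX.prob_start, Finset.prod_range_succ'] at h0
  simp only [if_true, Nat.succ_ne_zero, if_false, Nat.add_sub_cancel, zero_add, one_ne_zero,
    Nat.sub_self] at h0
  rw [ENNReal.ofReal_mul (m.init_nonneg i), mul_comm (Finset.prod _ _)] at h0
  exact (ENNReal.mul_right_inj (by simpa using m.init_pos i) ENNReal.ofReal_ne_top).1 h0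

/-- The Markov property of the chain for one fixed prefix of length `t + 1`. -/
theorem IsHMM.map_shift_restrict_prefix [IsFiniteMeasure P] (hX : IsHMM m P Y e h X) (t : ℕ) (s : ℕ → Fin K) :
    (P.restrict (path Y ⁻¹' seqCylinder (t + 1) s)).map (fun ω => shift (t + 1) (path Y ω)) =
      P (path Y ⁻¹' seqCylinder (t + 1) s) • chainKernel P Y (s t) := by
  have hm : Measurable (fun ω => shift (t + 1) (path Y ω)) :=
    (measurable_shift _).comp (measurable_path hX.measurable_Y)
  have := hX.isProbabilityMeasure_chainKernel (s t)
  have : Nonempty (Fin K) := ⟨s t⟩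
  refine ext_of_seqCylinder fun n w => ?_
  rw [Measure.map_apply hm (measurableSet_seqCylinder _ _),
    Measure.restrict_apply (hm (measurableSet_seqCylinder _ _)), Measure.smul_apply, smul_eq_mul]
  cases n with
  | zero => simp [seqCylinder]
  | succ n =>
    have h2 : (fun ω => shift (t + 1) (path Y ω)) ⁻¹' seqCylinder (n + 1) w ∩
        path Y ⁻¹' seqCylinder (t + 1) s = path Y ⁻¹' seqCylinder (t + 1 + n + 1)
          (fun j => if j < t + 1 then s j else w (j - (t + 1))) := by
      ext ω
      simp only [Set.mem_inter_iff, Set.mem_preimage, seqCylinder,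
        Set.mem_ofPred_eq, shift, path]
      constructor
      · rintro ⟨h, h'⟩ j hj
        split_ifs with hjt
        · exact h' j hjt
        · have := h (j - (t + 1)) (by omega)
          rwa [Nat.add_sub_cancel' (by omega)] at this
      · intro h
        refine ⟨fun j hj => ?_, fun j hj => ?_⟩
        · rw [h _ (by omega), if_neg (by omega)]
          simp
        · rw [h j (by omega), if_pos hj]
    rw [h2, hX.prob_prefix, hX.prob_prefix, hX.chainKernel_seqCylinder,
      ← ENNReal.ofReal_mul (mul_nonneg (m.init_nonneg _)
        (Finset.prod_nonneg fun _ _ => m.p_nonneg _ _))]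
    congr 1
    rw [Finset.prod_range_add, Finset.prod_range_succ]
    simp only [Nat.zero_lt_succ, if_true, mul_assoc]
    congr 2
    · refine Finset.prod_congr rfl fun j hj => ?_
      have := Finset.mem_range.1 hj
      rw [if_pos (by omega), if_pos (by omega)]
    · rw [if_pos (by omega), if_neg (by omega)]
      simp only [Nat.sub_self]
      congr 1
      refine Finset.prod_congr rfl fun j hj => ?_
      rw [if_neg (by omega), if_neg (by omega)]
      congr 2 <;> omega

/-- **Markov property of the hidden chain.** On `Y_t = i`, the future `(Y_{t+1}, Y_{t+2}, ...)` is
independent of the past `(Y_0, ..., Y_t)` and its law depends on `i` only. -/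
theorem IsHMM.chain_markov [IsFiniteMeasure P] (hX : IsHMM m P Y e h X) (t : ℕ) (i : Fin K) :
    (P.restrict (Y t ⁻¹' {i})).map (fun ω => (freeze (t + 1) (path Y ω), shift (t + 1) (path Y ω))) =
      ((P.restrict (Y t ⁻¹' {i})).map (fun ω => freeze (t + 1) (path Y ω))).prod
        (chainKernel P Y i) := by
  have hp := measurable_path hX.measurable_Y
  have hf : Measurable (fun ω => freeze (t + 1) (path Y ω)) := (measurable_freeze _).comp hp
  have hs : Measurable (fun ω => shift (t + 1) (path Y ω)) := (measurable_shift _).comp hp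
  have := hX.isProbabilityMeasure_chainKernel i
  symm
  refine Measure.prod_eq fun A F hA hF => ?_
  rw [Measure.map_apply (hf.prodMk hs) (hA.prod hF), Measure.map_apply hf hA,
    Measure.restrict_apply ((hf.prodMk hs) (hA.prod hF)), Measure.restrict_apply (hf hA)]
  -- the past takes finitely many values: split according to the prefix of length `t + 1`
  let c : (Fin (t + 1) → Fin K) → ℕ → Fin K := fun w j => w ⟨min j t, by omega⟩
  let D : (Fin (t + 1) → Fin K) → Set Ω := fun w => path Y ⁻¹' seqCylinder (t + 1) (c w)
  have hD : ∀ w, MeasurableSet (D w) := fun w => hp (measurableSet_seqCylinder _ _)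
  have hDd : Pairwise (Function.onFun Disjoint D) := by
    intro w w' hne
    refine Set.disjoint_left.2 fun ω hω hω' => hne (funext fun j => ?_)
    have h1 := hω j j.2
    have h2 := hω' j j.2
    have hj : (⟨min (j : ℕ) t, by omega⟩ : Fin (t + 1)) = j := Fin.ext (by simp; omega)
    simp only [c, hj] at h1 h2
    exact h1.symm.trans h2
  have hDu : ⋃ w, D w = Set.univ := by
    refine Set.eq_univ_of_forall fun ω => Set.mem_iUnion.2 ⟨fun j => Y j ω, fun j hj => ?_⟩
    simp [c, path, min_eq_left (Nat.lt_succ_iff.1 hj)]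
  have hsplit : ∀ E : Set Ω, MeasurableSet E → P E = ∑ w, P (E ∩ D w) := by
    intro E hE
    rw [← tsum_fintype (L := .unconditional _), ← measure_iUnion
      (fun w w' hne => ((hDd hne).mono Set.inter_subset_right Set.inter_subset_right))
      (fun w => hE.inter (hD w)), ← Set.inter_iUnion, hDu, Set.inter_univ]
  have hYt : MeasurableSet (Y t ⁻¹' {i}) := hX.measurable_Y t (measurableSet_singleton i)
  rw [hsplit _ (((hf.prodMk hs) (hA.prod hF)).inter hYt), hsplit _ ((hf hA).inter hYt),
    Finset.sum_mul]
  refine Finset.sum_congr rfl fun w _ => ?_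
  have hfr : ∀ ω ∈ D w, freeze (t + 1) (path Y ω) = freeze (t + 1) (c w) := fun ω hω =>
    freeze_eq_freeze (Nat.succ_pos t) hω
  have hlast : ∀ ω ∈ D w, Y t ω = c w t := fun ω hω => hω t (Nat.lt_succ_self t)
  by_cases hw : freeze (t + 1) (c w) ∈ A ∧ c w t = i
  · have e1 : (fun ω => (freeze (t + 1) (path Y ω), shift (t + 1) (path Y ω))) ⁻¹' A ×ˢ F ∩
        Y t ⁻¹' {i} ∩ D w = (fun ω => shift (t + 1) (path Y ω)) ⁻¹' F ∩ D w := by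
      ext ω
      constructor
      · rintro ⟨⟨h1, -⟩, h3⟩
        exact ⟨h1.2, h3⟩
      · rintro ⟨h1, h3⟩
        refine ⟨⟨⟨?_, h1⟩, ?_⟩, h3⟩
        · change freeze (t + 1) (path Y ω) ∈ A
          rw [hfr ω h3]; exact hw.1
        · exact (hlast ω h3).trans hw.2
    have e2 : (fun ω => freeze (t + 1) (path Y ω)) ⁻¹' A ∩ Y t ⁻¹' {i} ∩ D w = D w := by
      refine Set.inter_eq_right.2 fun ω h3 => ⟨?_, (hlast ω h3).trans hw.2⟩
      change freeze (t + 1) (path Y ω) ∈ A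
      rw [hfr ω h3]; exact hw.1
    rw [e1, e2, ← Measure.restrict_apply (hs hF), ← Measure.map_apply hs hF,
      hX.map_shift_restrict_prefix, hw.2]
    rfl
  · have e1 : ∀ E : Set Ω, (E ⊆ (fun ω => freeze (t + 1) (path Y ω)) ⁻¹' A) →
        E ∩ Y t ⁻¹' {i} ∩ D w = ∅ := by
      intro E hE
      refine Set.eq_empty_of_forall_notMem fun ω hω => hw ⟨?_, ?_⟩
      · rw [← hfr ω hω.2]; exact hE hω.1.1
      · rw [← hlast ω hω.2]; exact hω.1.2
    rw [e1 _ (fun ω hω => hω.1), e1 _ subset_rfl]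
    simp

end Chain

/-! ### The Markov property of the observed pairs -/

theorem map_prod_prod_comm {α β γ δ : Type*} [MeasurableSpace α] [MeasurableSpace β]
    [MeasurableSpace γ] [MeasurableSpace δ] (μ : Measure α) (ν : Measure β) (ρ : Measure γ)
    (σ : Measure δ) [IsFiniteMeasure μ] [IsFiniteMeasure ν] [IsFiniteMeasure ρ]
    [IsFiniteMeasure σ] :
    ((μ.prod ν).prod (ρ.prod σ)).map (fun x => ((x.1.1, x.2.1), (x.1.2, x.2.2))) =
      (μ.prod ρ).prod (ν.prod σ) := by
  symm
  refine Measure.prod_eq_generateFrom generateFrom_prod generateFrom_prod isPiSystem_prod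
    isPiSystem_prod
    ⟨fun _ => Set.univ, fun _ => ⟨Set.univ, .univ, Set.univ, .univ, by simp⟩,
      fun _ => measure_lt_top _ _, Set.iUnion_const _⟩
    ⟨fun _ => Set.univ, fun _ => ⟨Set.univ, .univ, Set.univ, .univ, by simp⟩,
      fun _ => measure_lt_top _ _, Set.iUnion_const _⟩ ?_
  rintro _ ⟨a, ha, c, hc, rfl⟩ _ ⟨b, hb, d, hd, rfl⟩
  have ha : MeasurableSet a := ha
  have hb : MeasurableSet b := hb
  have hc : MeasurableSet c := hc
  have hd : MeasurableSet d := hd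
  rw [Measure.map_apply (by fun_prop) ((ha.prod hc).prod (hb.prod hd))]
  have : (fun x : (α × β) × (γ × δ) => ((x.1.1, x.2.1), (x.1.2, x.2.2))) ⁻¹'
      ((a ×ˢ c) ×ˢ (b ×ˢ d)) = (a ×ˢ b) ×ˢ (c ×ˢ d) := by
    ext ⟨⟨_, _⟩, _, _⟩
    simp only [Set.mem_preimage, Set.mem_prod]
    tauto
  rw [this]
  simp only [Measure.prod_prod]
  ring

section Pairs

variable {K : ℕ} {𝒳 Ω 𝓔 : Type*} [MeasurableSpace 𝒳] [MeasurableSpace Ω]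
  [MeasurableSpace 𝓔] {m : HMMModel K 𝒳} {P : Measure Ω}
  {Y : ℕ → Ω → Fin K} {e : ℕ → Ω → 𝓔} {h : Fin K × 𝓔 → 𝒳} {X : ℕ → Ω → 𝒳}

/-- The state-observation sequence produced by the states `x.1` and the noise `x.2`. -/
def emit (h : Fin K × 𝓔 → 𝒳) (x : (ℕ → Fin K) × (ℕ → 𝓔)) : ℕ → Fin K × 𝒳 :=
  fun n => (x.1 n, h (x.1 n, x.2 n))

theorem measurable_emit (hh : Measurable h) : Measurable (emit h) := by
  unfold emit
  fun_prop

/-- The state-observation sequence `(Y_0, X_0), (Y_1, X_1), ...`. -/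
def pairPath (Y : ℕ → Ω → Fin K) (X : ℕ → Ω → 𝒳) (ω : Ω) : ℕ → Fin K × 𝒳 :=
  fun n => (Y n ω, X n ω)

theorem IsHMM.pairPath_eq (hX : IsHMM m P Y e h X) (ω : Ω) :
    pairPath Y X ω = emit h (path Y ω, path e ω) :=
  funext fun n => by simp only [pairPath, emit, path, hX.obs]

theorem IsHMM.measurable_X (hX : IsHMM m P Y e h X) (n : ℕ) : Measurable (X n) := by
  have : X n = fun ω => h (Y n ω, e n ω) := funext (hX.obs n)
  rw [this]
  exact hX.measurable_h.comp ((hX.measurable_Y n).prodMk (hX.measurable_e n))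

theorem IsHMM.measurable_pairPath (hX : IsHMM m P Y e h X) : Measurable (pairPath Y X) :=
  measurable_pi_lambda _ fun n => (hX.measurable_Y n).prodMk (hX.measurable_X n)

/-- The law of `((Y_1, X_1), (Y_2, X_2), ...)` given `Y_0 = i`. -/
def pairKernel (P : Measure Ω) (Y : ℕ → Ω → Fin K) (e : ℕ → Ω → 𝓔) (h : Fin K × 𝓔 → 𝒳)
    (i : Fin K) : Measure (ℕ → Fin K × 𝒳) :=
  ((chainKernel P Y i).prod (P.map (path e))).map (emit h)

theorem IsHMM.isProbabilityMeasure_pairKernel [IsProbabilityMeasure P]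
    (hX : IsHMM m P Y e h X) (i : Fin K) : IsProbabilityMeasure (pairKernel P Y e h i) := by
  have := hX.isProbabilityMeasure_chainKernel i
  have : IsProbabilityMeasure (P.map (path e)) :=
    Measure.isProbabilityMeasure_map (measurable_path hX.measurable_e).aemeasurable
  exact Measure.isProbabilityMeasure_map (measurable_emit hX.measurable_h).aemeasurable

theorem IsHMM.map_shift_noise [IsProbabilityMeasure P] (hX : IsHMM m P Y e h X) (t : ℕ) :
    P.map (fun ω => shift t (path e ω)) = P.map (path e) := by
  have h1 : iIndepFun (fun n => e (t + n)) P :=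
    hX.e_indep.precomp (g := fun n => t + n) (add_right_injective t)
  have h2 := (iIndepFun_iff_map_fun_eq_infinitePi_map
    (fun n => (hX.measurable_e (t + n)))).1 h1
  have h3 := (iIndepFun_iff_map_fun_eq_infinitePi_map (fun n => hX.measurable_e n)).1 hX.e_indep
  refine h2.trans (Eq.trans ?_ h3.symm)
  congr 1
  funext n
  exact ((hX.e_ident (t + n)).trans (hX.e_ident n).symm).map_eq

/-- The noise up to time `t` is independent of the noise after it, which has the law of the
whole noise sequence. -/
theorem IsHMM.noise_split [IsProbabilityMeasure P] (hX : IsHMM m P Y e h X) (t : ℕ) :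
    P.map (fun ω => (freeze (t + 1) (path e ω), shift (t + 1) (path e ω))) =
      (P.map (fun ω => freeze (t + 1) (path e ω))).prod (P.map (path e)) := by
  have hp := measurable_path hX.measurable_e
  have hf : Measurable (fun ω => freeze (t + 1) (path e ω)) := (measurable_freeze _).comp hp
  have hs : Measurable (fun ω => shift (t + 1) (path e ω)) := (measurable_shift _).comp hp
  rw [← hX.map_shift_noise (t + 1)]
  refine (indepFun_iff_map_prod_eq_prod_map_map hf.aemeasurable hs.aemeasurable).1 ?_
  have hI := indep_iSup_of_disjoint (fun n => (hX.measurable_e n).comap_le)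
    ((iIndepFun_iff_iIndep _ _ _).1 hX.e_indep) (S := Set.Iio (t + 1)) (T := Set.Ici (t + 1))
    (Set.disjoint_left.2 fun n h1 h2 => (Set.mem_Iio.1 h1).not_ge (Set.mem_Ici.1 h2))
  rw [IndepFun_iff_Indep]
  refine indep_of_indep_of_le_left (indep_of_indep_of_le_right hI ?_) ?_
  · refine Measurable.comap_le (@measurable_pi_lambda _ _ _ (_) _ _ fun n => ?_)
    exact Measurable.mono (comap_measurable (e (t + 1 + n)))
      (le_iSup₂_of_le (t + 1 + n) (Nat.le_add_right _ _) le_rfl) le_rfl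
  · refine Measurable.comap_le (@measurable_pi_lambda _ _ _ (_) _ _ fun n => ?_)
    exact Measurable.mono (comap_measurable (e (min n t)))
      (le_iSup₂_of_le (min n t) (Nat.lt_succ_of_le (min_le_right _ _)) le_rfl) le_rfl

/-- **Markov property of the state-observation sequence.** On `Y_t = i`, the future after time `t`
is independent of the past up to time `t`, and its law depends on `i` only. -/
theorem IsHMM.pair_markov [IsProbabilityMeasure P] (hX : IsHMM m P Y e h X) (t : ℕ) (i : Fin K) :
    (P.restrict (Y t ⁻¹' {i})).map
        (fun ω => (freeze (t + 1) (pairPath Y X ω), shift (t + 1) (pairPath Y X ω))) =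
      ((P.restrict (Y t ⁻¹' {i})).map (fun ω => freeze (t + 1) (pairPath Y X ω))).prod
        (pairKernel P Y e h i) := by
  have hY := measurable_path hX.measurable_Y
  have he := measurable_path hX.measurable_e
  have := hX.isProbabilityMeasure_chainKernel i
  have := hX.isProbabilityMeasure_pairKernel i
  have : IsProbabilityMeasure (P.map (path e)) := Measure.isProbabilityMeasure_map he.aemeasurable
  let D : Set (ℕ → Fin K) := (fun y => y t) ⁻¹' {i}
  have hD : MeasurableSet D := measurable_pi_apply t (measurableSet_singleton i)
  have hsplitY : Measurable fun y : ℕ → Fin K => (freeze (t + 1) y, shift (t + 1) y) :=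
    (measurable_freeze _).prodMk (measurable_shift _)
  have hsplitE : Measurable fun y : ℕ → 𝓔 => (freeze (t + 1) y, shift (t + 1) y) :=
    (measurable_freeze _).prodMk (measurable_shift _)
  have hemit := measurable_emit hX.measurable_h
  have hcomm : Measurable fun x : ((ℕ → Fin K) × (ℕ → Fin K)) × ((ℕ → 𝓔) × (ℕ → 𝓔)) =>
    ((x.1.1, x.2.1), (x.1.2, x.2.2)) := by fun_prop
  have hjoint : (P.restrict (Y t ⁻¹' {i})).map (fun ω => (path Y ω, path e ω)) =
      ((P.restrict (Y t ⁻¹' {i})).map (path Y)).prod (P.map (path e)) := by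
    have h1 : P.map (fun ω => (path Y ω, path e ω)) = (P.map (path Y)).prod (P.map (path e)) :=
      (indepFun_iff_map_prod_eq_prod_map_map hY.aemeasurable he.aemeasurable).1 hX.e_indep_Y
    have h2 : (P.restrict (Y t ⁻¹' {i})).map (fun ω => (path Y ω, path e ω)) =
        (P.map (fun ω => (path Y ω, path e ω))).restrict (D ×ˢ Set.univ) := by
      rw [Measure.restrict_map (hY.prodMk he) (hD.prod .univ)]
      congr 2
      ext ω
      simp [D, path]
    have h3 : (P.restrict (Y t ⁻¹' {i})).map (path Y) = (P.map (path Y)).restrict D := by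
      rw [Measure.restrict_map hY hD]
      rfl
    rw [h2, h1, h3, Measure.restrict_prod_eq_prod_univ]
  have hmain : (P.restrict (Y t ⁻¹' {i})).map
        (fun ω => (freeze (t + 1) (pairPath Y X ω), shift (t + 1) (pairPath Y X ω))) =
      ((((P.restrict (Y t ⁻¹' {i})).map (fun ω => freeze (t + 1) (path Y ω))).prod
        (P.map (fun ω => freeze (t + 1) (path e ω)))).map (emit h)).prod
        (pairKernel P Y e h i) := by
    have hfun : (fun ω => (freeze (t + 1) (pairPath Y X ω), shift (t + 1) (pairPath Y X ω))) =
        Prod.map (emit h) (emit h) ∘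
          (fun x : ((ℕ → Fin K) × (ℕ → Fin K)) × ((ℕ → 𝓔) × (ℕ → 𝓔)) =>
            ((x.1.1, x.2.1), (x.1.2, x.2.2))) ∘
          Prod.map (fun y => (freeze (t + 1) y, shift (t + 1) y))
            (fun y => (freeze (t + 1) y, shift (t + 1) y)) ∘ fun ω => (path Y ω, path e ω) := by
      funext ω
      rw [hX.pairPath_eq]
      rfl
    rw [hfun, ← Measure.map_map (hemit.prodMap hemit) (hcomm.comp
        ((hsplitY.prodMap hsplitE).comp (hY.prodMk he))),
      ← Measure.map_map hcomm ((hsplitY.prodMap hsplitE).comp (hY.prodMk he)),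
      ← Measure.map_map (hsplitY.prodMap hsplitE) (hY.prodMk he), hjoint,
      ← Measure.map_prod_map _ _ hsplitY hsplitE, Measure.map_map hsplitY hY,
      Measure.map_map hsplitE he]
    have e1 := hX.chain_markov t i
    have e2 := hX.noise_split t
    rw [show (fun y : ℕ → Fin K => (freeze (t + 1) y, shift (t + 1) y)) ∘ path Y =
        fun ω => (freeze (t + 1) (path Y ω), shift (t + 1) (path Y ω)) from rfl, e1,
      show (fun y : ℕ → 𝓔 => (freeze (t + 1) y, shift (t + 1) y)) ∘ path e =
        fun ω => (freeze (t + 1) (path e ω), shift (t + 1) (path e ω)) from rfl, e2,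
      map_prod_prod_comm, pairKernel, Measure.map_prod_map _ _ hemit hemit]
  rw [hmain]
  congr 1
  have hfst := congrArg (Measure.map Prod.fst) hmain
  rw [Measure.map_fst_prod, measure_univ, one_smul, Measure.map_map measurable_fst] at hfst
  · exact hfst.symm
  · exact ((measurable_freeze _).comp hX.measurable_pairPath).prodMk
      ((measurable_shift _).comp hX.measurable_pairPath)

/-- `IsHMM.pair_markov` for events: `A` constrains the past and `F` the future. -/
theorem IsHMM.measure_past_inter_future [IsProbabilityMeasure P] (hX : IsHMM m P Y e h X) (t : ℕ)
    (i : Fin K) {A F : Set (ℕ → Fin K × 𝒳)} (hA : MeasurableSet A) (hF : MeasurableSet F) :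
    P {ω | Y t ω = i ∧ freeze (t + 1) (pairPath Y X ω) ∈ A ∧ shift (t + 1) (pairPath Y X ω) ∈ F} =
      P {ω | Y t ω = i ∧ freeze (t + 1) (pairPath Y X ω) ∈ A} * pairKernel P Y e h i F := by
  have := hX.isProbabilityMeasure_pairKernel i
  have hf : Measurable (fun ω => freeze (t + 1) (pairPath Y X ω)) :=
    (measurable_freeze _).comp hX.measurable_pairPath
  have hs : Measurable (fun ω => shift (t + 1) (pairPath Y X ω)) :=
    (measurable_shift _).comp hX.measurable_pairPath
  have hh := congrArg (fun μ => μ (A ×ˢ F)) (hX.pair_markov t i)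
  rw [Measure.prod_prod, Measure.map_apply (hf.prodMk hs) (hA.prod hF), Measure.map_apply hf hA,
    Measure.restrict_apply ((hf.prodMk hs) (hA.prod hF)), Measure.restrict_apply (hf hA)] at hh
  convert! hh using 2
  · ext ω
    simp only [Set.mem_ofPred_eq, Set.mem_inter_iff, Set.mem_preimage, Set.mem_prod,
      Set.mem_singleton_iff]
    tauto
  · congr 1
    ext ω
    simp only [Set.mem_ofPred_eq, Set.mem_inter_iff, Set.mem_preimage, Set.mem_singleton_iff]
    tauto

end Pairs

/-! ### Recurrence of the barriers emitted along the special path -/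

section Recurrence

variable {K M : ℕ} {𝒳 Ω 𝓔 : Type*}

/-- A block of observations in `B`, emitted along the state path `q`, starts right after the first
`k` values of `z`. -/
def IsGood (B : Set (Fin M → 𝒳)) (q : Fin M → Fin K) (z : ℕ → Fin K × 𝒳) (k : ℕ) : Prop :=
  (fun j : Fin M => (z (k + j)).2) ∈ B ∧ (fun j : Fin M => (z (k + j)).1) = q

theorem isGood_congr {B : Set (Fin M → 𝒳)} {q : Fin M → Fin K} {z w : ℕ → Fin K × 𝒳} {k : ℕ}
    (h : ∀ j < M, z (k + j) = w (k + j)) : IsGood B q z k ↔ IsGood B q w k := by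
  have : ∀ j : Fin M, z (k + j) = w (k + j) := fun j => h j j.2
  simp only [IsGood, this]

theorem isGood_shift {B : Set (Fin M → 𝒳)} {q : Fin M → Fin K} {z : ℕ → Fin K × 𝒳} {t k : ℕ} :
    IsGood B q (shift t z) k ↔ IsGood B q z (t + k) := by
  simp only [IsGood, shift, add_assoc]

variable [MeasurableSpace 𝒳] [MeasurableSpace Ω] [MeasurableSpace 𝓔]

theorem measurableSet_isGood {B : Set (Fin M → 𝒳)} (hB : MeasurableSet B) (q : Fin M → Fin K)
    (k : ℕ) : MeasurableSet {z : ℕ → Fin K × 𝒳 | IsGood B q z k} := by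
  have h1 : Measurable fun (z : ℕ → Fin K × 𝒳) (j : Fin M) => (z (k + j)).2 := by fun_prop
  have h2 : Measurable fun (z : ℕ → Fin K × 𝒳) (j : Fin M) => (z (k + j)).1 := by fun_prop
  exact (h1 hB).inter (h2 (measurableSet_singleton q))

variable {m : HMMModel K 𝒳} {P : Measure Ω} [IsProbabilityMeasure P]
  {Y : ℕ → Ω → Fin K} {e : ℕ → Ω → 𝓔} {h : Fin K × 𝓔 → 𝒳} {X : ℕ → Ω → 𝒳}

theorem IsHMM.pairKernel_step (hX : IsHMM m P Y e h X) (i k : Fin K) :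
    pairKernel P Y e h i {z | (z 0).1 = k} = ENNReal.ofReal (m.p i k) := by
  have := hX.isProbabilityMeasure_chainKernel i
  have : IsProbabilityMeasure (P.map (path e)) :=
    Measure.isProbabilityMeasure_map (measurable_path hX.measurable_e).aemeasurable
  have hm : MeasurableSet {z : ℕ → Fin K × 𝒳 | (z 0).1 = k} := by
    have : Measurable fun z : ℕ → Fin K × 𝒳 => (z 0).1 := by fun_prop
    exact this (measurableSet_singleton k)
  rw [pairKernel, Measure.map_apply (measurable_emit hX.measurable_h) hm]
  have : emit h ⁻¹' {z | (z 0).1 = k} = seqCylinder 1 (fun _ => k) ×ˢ Set.univ := by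
    ext ⟨y, x⟩
    simp [emit, seqCylinder]
  rw [this, Measure.prod_prod, hX.chainKernel_seqCylinder]
  simp

/-- A positive entry of `m.p ^ n` makes the corresponding transition in `n` steps possible. -/
theorem IsHMM.prob_start_pow_pos (hX : IsHMM m P Y e h X) (i : Fin K) (n : ℕ) :
    ∀ k, 0 < (m.p ^ n) i k → 0 < P {ω | Y n ω = k ∧ Y 0 ω = i} := by
  induction n with
  | zero =>
    intro k hk
    have hik : i = k := by
      by_contra hne
      simp [hne] at hk
    subst hik
    simp only [and_self]
    have := hX.prob_start i
    rw [show {ω | Y 0 ω = i} = Y 0 ⁻¹' {i} from rfl, this]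
    simpa using m.init_pos i
  | succ n ih =>
    intro k hk
    rw [pow_succ, Matrix.mul_apply] at hk
    obtain ⟨j, -, hj⟩ := Finset.exists_lt_of_sum_lt
      (show ∑ _j : Fin K, (0 : ℝ) < ∑ j, (m.p ^ n) i j * m.p j k by simpa using hk)
    have h1 : 0 < (m.p ^ n) i j := pos_of_mul_pos_left hj (m.p_nonneg j k)
    have h2 : 0 < m.p j k := pos_of_mul_pos_right hj h1.le
    have hA : MeasurableSet {z : ℕ → Fin K × 𝒳 | (z 0).1 = i} := by
      have : Measurable fun z : ℕ → Fin K × 𝒳 => (z 0).1 := by fun_prop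
      exact this (measurableSet_singleton i)
    have hF : MeasurableSet {z : ℕ → Fin K × 𝒳 | (z 0).1 = k} := by
      have : Measurable fun z : ℕ → Fin K × 𝒳 => (z 0).1 := by fun_prop
      exact this (measurableSet_singleton k)
    have h3 := hX.measure_past_inter_future n j hA hF
    rw [hX.pairKernel_step] at h3
    have h4 : 0 < P {ω | Y n ω = j ∧ freeze (n + 1) (pairPath Y X ω) ∈
        {z : ℕ → Fin K × 𝒳 | (z 0).1 = i}} := by
      simpa [freeze, pairPath] using ih j h1
    have h5 := ENNReal.mul_pos h4.ne' (ENNReal.ofReal_pos.2 h2).ne'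
    rw [← h3] at h5
    refine h5.trans_le (measure_mono ?_)
    rintro ω ⟨-, hω1, hω2⟩
    exact ⟨by simpa [shift, pairPath] using hω2, by simpa [freeze, pairPath] using hω1⟩

variable {B : Set (Fin M → 𝒳)} {q : Fin M → Fin K}

/-- From some state, a barrier emitted along `q` can start at the next step. -/
theorem IsHMM.exists_pairKernel_good_pos (hX : IsHMM m P Y e h X) (hM : 0 < M)
    (hB : MeasurableSet B) (hqB : 0 < P {ω | IsGood B q (pairPath Y X ω) 0}) :
    ∃ k, 0 < pairKernel P Y e h k {z | IsGood B q z 0} := by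
  obtain ⟨M, rfl⟩ : ∃ M', M = M' + 1 := ⟨M - 1, by omega⟩
  have hen : IsProbabilityMeasure (P.map (path e)) :=
    Measure.isProbabilityMeasure_map (measurable_path hX.measurable_e).aemeasurable
  let w : ℕ → Fin K := fun j => q ⟨min j M, by omega⟩
  let N : Set (ℕ → 𝓔) := {x | (fun j : Fin (M + 1) => h (q j, x j)) ∈ B}
  have hw : ∀ j : Fin (M + 1), w j = q j := fun j => by
    simp only [w]; congr 1; ext; simp; omega
  have hN : MeasurableSet N := by
    have hh := hX.measurable_h
    have : Measurable fun (x : ℕ → 𝓔) (j : Fin (M + 1)) => h (q j, x j) := by fun_prop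
    exact this hB
  have hpre : emit h ⁻¹' {z | IsGood B q z 0} = seqCylinder (M + 1) w ×ˢ N := by
    ext ⟨y, x⟩
    simp only [Set.mem_preimage, Set.mem_ofPred_eq, IsGood, emit, Set.mem_prod, seqCylinder, N,
      zero_add]
    have hcyl : (∀ j < M + 1, y j = w j) ↔ (fun j : Fin (M + 1) => y j) = q :=
      ⟨fun H => funext fun j => (H j j.2).trans (hw j),
        fun H j hj => (congrFun H ⟨j, hj⟩).trans (hw ⟨j, hj⟩).symm⟩
    rw [hcyl, and_comm]
    refine and_congr_right fun H => ?_
    simp only [← H]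
  have hprod : 0 < P (path Y ⁻¹' seqCylinder (M + 1) w) ∧ 0 < P.map (path e) N := by
    rw [Measure.map_apply (measurable_path hX.measurable_e) hN]
    have hmem : ∀ ω, IsGood B q (pairPath Y X ω) 0 →
        (path Y ω, path e ω) ∈ seqCylinder (M + 1) w ×ˢ N := fun ω hω => by
      rw [hX.pairPath_eq] at hω
      rw [← hpre]; exact hω
    exact ⟨hqB.trans_le (measure_mono fun ω hω => (hmem ω hω).1),
      hqB.trans_le (measure_mono fun ω hω => (hmem ω hω).2)⟩
  rw [hX.prob_prefix, ENNReal.ofReal_pos] at hprod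
  have hpos : 0 < ∏ j ∈ Finset.range M, m.p (w j) (w (j + 1)) :=
    pos_of_mul_pos_right hprod.1 (m.init_nonneg _)
  -- by stationarity the first state of `q` has a predecessor
  obtain ⟨k, -, hk⟩ := Finset.exists_lt_of_sum_lt
    (show ∑ _j : Fin K, (0 : ℝ) < ∑ j, m.init j * m.p j (w 0) by
      rw [m.init_stationary]; simpa using m.init_pos (w 0))
  refine ⟨k, ?_⟩
  have := hX.isProbabilityMeasure_chainKernel k
  rw [pairKernel, Measure.map_apply (measurable_emit hX.measurable_h)
    (measurableSet_isGood hB q 0), hpre, Measure.prod_prod, hX.chainKernel_seqCylinder]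
  exact ENNReal.mul_pos (ENNReal.ofReal_pos.2
    (mul_pos (pos_of_mul_pos_right hk (m.init_nonneg _)) hpos)).ne' hprod.2.ne'

/-- Irreducibility transfers `IsHMM.exists_pairKernel_good_pos` to every initial state. -/
theorem IsHMM.exists_pairKernel_hit_pos (hX : IsHMM m P Y e h X) (hM : 0 < M)
    (hB : MeasurableSet B) (hqB : 0 < P {ω | IsGood B q (pairPath Y X ω) 0}) (i : Fin K) :
    ∃ n, 0 < pairKernel P Y e h i {z | IsGood B q z n} := by
  obtain ⟨k, hk⟩ := hX.exists_pairKernel_good_pos hM hB hqB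
  obtain ⟨n, -, hn⟩ := (Matrix.isIrreducible_iff_exists_pow_pos m.p_nonneg).1 m.p_irreducible i k
  refine ⟨n, ?_⟩
  have hA : MeasurableSet {z : ℕ → Fin K × 𝒳 | (z 0).1 = i} := by
    have : Measurable fun z : ℕ → Fin K × 𝒳 => (z 0).1 := by fun_prop
    exact this (measurableSet_singleton i)
  have h1 := hX.measure_past_inter_future n k hA (measurableSet_isGood hB q 0)
  have h2 : 0 < P {ω | Y n ω = k ∧ freeze (n + 1) (pairPath Y X ω) ∈
      {z : ℕ → Fin K × 𝒳 | (z 0).1 = i}} := by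
    simpa [freeze, pairPath] using hX.prob_start_pow_pos i n k hn
  have h3 := ENNReal.mul_pos h2.ne' hk.ne'
  rw [← h1] at h3
  have h4 := hX.measure_past_inter_future 0 i MeasurableSet.univ (measurableSet_isGood hB q n)
  refine pos_iff_ne_zero.2 fun h0 => ?_
  rw [h0, mul_zero] at h4
  refine h3.ne' (measure_mono_null ?_ h4)
  rintro ω ⟨-, hω1, hω2⟩
  refine ⟨by simpa [freeze, pairPath] using hω1, trivial, ?_⟩
  rw [Set.mem_ofPred_eq, isGood_shift] at hω2 ⊢
  rwa [show 0 + 1 + n = n + 1 + 0 by ring]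

/-- From whichever state, a barrier emitted along `q` starts within a bounded time with probability
bounded away from `0`. -/
theorem IsHMM.exists_uniform_miss (hX : IsHMM m P Y e h X) (hM : 0 < M)
    (hB : MeasurableSet B) (hqB : 0 < P {ω | IsGood B q (pairPath Y X ω) 0}) :
    ∃ (L : ℕ) (δ : ENNReal), δ < 1 ∧
      ∀ i, pairKernel P Y e h i {z | ∀ n < L, ¬ IsGood B q z n} ≤ δ := by
  choose n hn using hX.exists_pairKernel_hit_pos hM hB hqB
  refine ⟨Finset.univ.sup n + 1, Finset.univ.sup fun i => pairKernel P Y e h i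
    {z | ∀ k < Finset.univ.sup n + 1, ¬ IsGood B q z k}, ?_, fun i =>
    Finset.le_sup (f := fun i => pairKernel P Y e h i
    {z | ∀ k < Finset.univ.sup n + 1, ¬ IsGood B q z k}) (Finset.mem_univ i)⟩
  rw [Finset.sup_lt_iff (by simp)]
  intro i _
  have := hX.isProbabilityMeasure_pairKernel i
  have hle : pairKernel P Y e h i {z | ∀ k < Finset.univ.sup n + 1, ¬ IsGood B q z k} ≤
      pairKernel P Y e h i {z | IsGood B q z (n i)}ᶜ :=
    measure_mono fun z hz => hz _ (Nat.lt_succ_of_le (Finset.le_sup (Finset.mem_univ i)))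
  refine hle.trans_lt ?_
  rw [prob_compl_eq_one_sub (measurableSet_isGood hB q _)]
  exact ENNReal.sub_lt_self ENNReal.one_ne_top one_ne_zero (hn i).ne'

theorem IsHMM.ae_infinite_isGood (hX : IsHMM m P Y e h X) (hM : 0 < M)
    (hB : MeasurableSet B) (hqB : 0 < P {ω | IsGood B q (pairPath Y X ω) 0}) :
    ∀ᵐ ω ∂P, {k | IsGood B q (pairPath Y X ω) k}.Infinite := by
  obtain ⟨L, δ, hδ, hL⟩ := hX.exists_uniform_miss hM hB hqB
  have hmiss : ∀ T, P {ω | ∀ n, T < n → ¬ IsGood B q (pairPath Y X ω) n} = 0 := by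
    intro T
    -- no barrier starts in the first `k` windows of length `L`, consecutive windows being a full
    -- barrier length apart
    let N : ℕ → Set (ℕ → Fin K × 𝒳) := fun k =>
      {z | ∀ j < k, ∀ n < L, ¬ IsGood B q z (T + j * (L + M) + 1 + n)}
    have hNm : ∀ k, MeasurableSet (N k) := by
      intro k
      have : N k = ⋂ j, ⋂ (_ : j < k), ⋂ n, ⋂ (_ : n < L),
          {z | IsGood B q z (T + j * (L + M) + 1 + n)}ᶜ := by
        ext z; simp [N]
      rw [this]
      exact .iInter fun j => .iInter fun _ => .iInter fun n => .iInter fun _ =>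
        (measurableSet_isGood hB q _).compl
    have hHm : MeasurableSet {z : ℕ → Fin K × 𝒳 | ∀ n < L, ¬ IsGood B q z n} := by
      have : {z : ℕ → Fin K × 𝒳 | ∀ n < L, ¬ IsGood B q z n} = ⋂ n, ⋂ (_ : n < L),
          {z | IsGood B q z n}ᶜ := by
        ext z; simp
      rw [this]
      exact .iInter fun n => .iInter fun _ => (measurableSet_isGood hB q _).compl
    have hNf : ∀ k z, freeze (T + k * (L + M) + 1) z ∈ N k ↔ z ∈ N k := by
      intro k z
      refine forall₂_congr fun j hj => forall₂_congr fun n hn => not_congr (isGood_congr ?_)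
      intro i hi
      refine freeze_apply_of_lt z ?_
      have : (j + 1) * (L + M) ≤ k * (L + M) := Nat.mul_le_mul_right _ hj
      rw [add_mul, one_mul] at this
      omega
    have hsucc : ∀ k z, z ∈ N (k + 1) ↔ z ∈ N k ∧
        shift (T + k * (L + M) + 1) z ∈ {z | ∀ n < L, ¬ IsGood B q z n} := by
      intro k z
      simp only [N, Set.mem_ofPred_eq, isGood_shift]
      refine ⟨fun H => ⟨fun j hj => H j (by omega), H k (by omega)⟩, fun H j hj => ?_⟩
      rcases Nat.lt_succ_iff_lt_or_eq.1 hj with hj | rfl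
      · exact H.1 j hj
      · exact H.2
    have hdecay : ∀ k, P (pairPath Y X ⁻¹' N k) ≤ δ ^ k := by
      intro k
      induction k with
      | zero => simpa using prob_le_one
      | succ k ih =>
        have hsum : ∀ E : Set Ω, MeasurableSet E →
            P E = ∑ i, P (Y (T + k * (L + M)) ⁻¹' {i} ∩ E) := by
          intro E hE
          rw [← tsum_fintype (L := .unconditional _), ← measure_iUnion]
          · congr 1
            ext ω; simp
          · intro i j hij
            refine Set.disjoint_left.2 fun ω h1 h2 => hij ?_
            exact (Set.mem_singleton_iff.1 h1.1).symm.trans h2.1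
          · exact fun i => (hX.measurable_Y _ (measurableSet_singleton i)).inter hE
        rw [hsum _ (hX.measurable_pairPath (hNm (k + 1))), pow_succ]
        calc ∑ i, P (Y (T + k * (L + M)) ⁻¹' {i} ∩ pairPath Y X ⁻¹' N (k + 1))
            ≤ ∑ i, P (Y (T + k * (L + M)) ⁻¹' {i} ∩ pairPath Y X ⁻¹' N k) * δ := by
              refine Finset.sum_le_sum fun i _ => ?_
              have h1 := hX.measure_past_inter_future (T + k * (L + M)) i (hNm k) hHm
              simp only [hNf] at h1
              have e1 : Y (T + k * (L + M)) ⁻¹' {i} ∩ pairPath Y X ⁻¹' N (k + 1) =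
                  {ω | Y (T + k * (L + M)) ω = i ∧ pairPath Y X ω ∈ N k ∧
                    shift (T + k * (L + M) + 1) (pairPath Y X ω) ∈
                      {z | ∀ n < L, ¬ IsGood B q z n}} := by
                ext ω
                simp only [Set.mem_inter_iff, Set.mem_preimage, Set.mem_singleton_iff, hsucc]
                rfl
              rw [e1, h1]
              exact mul_le_mul_right (hL i) _
          _ = P (pairPath Y X ⁻¹' N k) * δ := by
              rw [← Finset.sum_mul, ← hsum _ (hX.measurable_pairPath (hNm k))]
          _ ≤ δ ^ k * δ := by gcongr
    refine le_antisymm (ge_of_tendsto' (ENNReal.tendsto_pow_atTop_nhds_zero_of_lt_one hδ)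
      fun k => le_trans (measure_mono ?_) (hdecay k)) zero_le
    intro ω hω j _ n _
    exact hω _ (by omega)
  have hall : ∀ᵐ ω ∂P, ∀ T, ¬ ∀ n, T < n → ¬ IsGood B q (pairPath Y X ω) n :=
    ae_all_iff.2 fun T => by
      rw [ae_iff]
      simpa only [not_not] using hmiss T
  filter_upwards [hall] with ω hω
  refine Set.infinite_of_forall_exists_gt fun T => ?_
  have := hω T
  push Not at this
  obtain ⟨n, hn, hg⟩ := this
  exact ⟨n, hg, hn⟩

end Recurrence

/-! ### Counting the elements of a set of times -/

section Counting

open Classical in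
theorem Nat.count_congr_of_lt {p p' : ℕ → Prop} {n : ℕ} (h : ∀ k < n, p k ↔ p' k) :
    Nat.count p n = Nat.count p' n :=
  le_antisymm (Nat.count_mono_left fun k hk => (h k hk).1)
    (Nat.count_mono_left fun k hk => (h k hk).2)

theorem Nat.nth_eq_iff_of_infinite {p : ℕ → Prop} [DecidablePred p] (hp : {k | p k}.Infinite)
    {i k : ℕ} : Nat.nth p i = k ↔ p k ∧ Nat.count p k = i := by
  constructor
  · rintro rfl
    exact ⟨Nat.nth_mem_of_infinite hp i, Nat.count_nth_of_infinite hp i⟩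
  · rintro ⟨hk, rfl⟩
    exact Nat.nth_count hk

theorem Nat.nth_congr_of_le {p p' : ℕ → Prop} (hp : {k | p k}.Infinite) {i j : ℕ} (hj : j ≤ i)
    (h : ∀ k ≤ Nat.nth p i, p k ↔ p' k) : Nat.nth p' j = Nat.nth p j := by
  classical
  have hle := Nat.nth_monotone hp hj
  have h1 := (h _ hle).1 (Nat.nth_mem_of_infinite hp j)
  have h2 : Nat.count p' (Nat.nth p j) = j := by
    rw [← Nat.count_congr_of_lt (p := p) fun k hk => h k (hk.le.trans hle)]
    exact Nat.count_nth_of_infinite hp j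
  rw [← Nat.nth_count h1, h2]

/-- If `p` has exactly `i + 1` elements before `t`, the later ones are those of the shifted set. -/
theorem Nat.nth_add_of_gap {p : ℕ → Prop} (hp : {k | p k}.Infinite) {i k t : ℕ}
    (hk : Nat.nth p i = k) (hkt : k < t) (hgap : ∀ k', k < k' → k' < t → ¬ p k') (j : ℕ) :
    Nat.nth p (i + 1 + j) = t + Nat.nth (fun n => p (t + n)) j := by
  classical
  have hcount : Nat.count p t = i + 1 := by
    obtain ⟨d, rfl⟩ : ∃ d, t = k + 1 + d := ⟨t - (k + 1), by omega⟩
    have hzero : Nat.count (fun n => p (k + 1 + n)) d = 0 :=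
      Nat.count_iff_forall_not.2 fun n hn => hgap _ (by omega) (by omega)
    rw [Nat.count_add, hzero, ← hk, Nat.count_nth_succ_of_infinite hp]
  have hinf : {n | p (t + n)}.Infinite := by
    refine Set.infinite_of_forall_exists_gt fun n => ?_
    obtain ⟨b, hb, hlt⟩ := hp.exists_gt (t + n)
    refine ⟨b - t, ?_, by omega⟩
    change p (t + (b - t))
    rwa [Nat.add_sub_cancel' (by omega)]
  have h1 := Nat.nth_mem_of_infinite hinf j
  have h2 : Nat.count p (t + Nat.nth (fun n => p (t + n)) j) = i + 1 + j := by
    rw [Nat.count_add, hcount, Nat.count_nth_of_infinite hinf]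
  rw [← h2]
  exact Nat.nth_count h1

variable {α : Type*} [MeasurableSpace α] {p : α → ℕ → Prop}

open Classical in
theorem measurable_count_of_measurableSet (hp : ∀ k, MeasurableSet {a | p a k}) (n : ℕ) :
    Measurable fun a => Nat.count (p a) n := by
  induction n with
  | zero => simp
  | succ n ih =>
    simp only [Nat.count_succ]
    exact ih.add (Measurable.ite (hp n) measurable_const measurable_const)

theorem measurable_nth_of_measurableSet (hp : ∀ k, MeasurableSet {a | p a k}) (n : ℕ) :
    Measurable fun a => Nat.nth (p a) n := by
  classical
  -- away from the default value `0`, the equation `nth p n = k` reads `p k ∧ count p k = n`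
  have hpos : ∀ k, k ≠ 0 → MeasurableSet {a | Nat.nth (p a) n = k} := by
    intro k hk
    have : {a | Nat.nth (p a) n = k} = {a | p a k} ∩ {a | Nat.count (p a) k = n} := by
      ext a
      constructor
      · intro h
        have h : Nat.nth (p a) n = k := h
        have hne : Nat.nth (p a) n ≠ 0 := h.symm ▸ hk
        have h1 := Nat.nth_mem_of_ne_zero hne
        have h2 := Nat.count_nth (Nat.lt_card_toFinset_of_nth_ne_zero hne)
        rw [h] at h1 h2
        exact ⟨h1, h2⟩
      · rintro ⟨h1, h2⟩
        have h2 : Nat.count (p a) k = n := h2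
        change Nat.nth (p a) n = k
        rw [← h2]
        exact Nat.nth_count h1
    rw [this]
    exact (hp k).inter (measurable_count_of_measurableSet hp k (measurableSet_singleton n))
  refine measurable_to_countable' fun k => ?_
  by_cases hk : k = 0
  · have : (fun a => Nat.nth (p a) n) ⁻¹' {k} =
        (⋃ k', ⋃ (_ : k' ≠ 0), {a | Nat.nth (p a) n = k'})ᶜ := by
      ext a
      simp only [hk, Set.mem_preimage, Set.mem_singleton_iff, Set.mem_compl_iff, Set.mem_iUnion,
        Set.mem_ofPred_eq, not_exists]
      exact ⟨fun h0 k' hk' h1 => hk' (h1.symm.trans h0), fun H => by_contra fun h0 => H _ h0 rfl⟩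
    rw [this]
    exact (MeasurableSet.iUnion fun k' => MeasurableSet.iUnion fun hk' => hpos k' hk').compl
  · exact hpos k hk

end Counting

/-! ### Piecewise alignments -/

section Alignment

variable {K M : ℕ} [NeZero K] {𝒳 : Type*} [MeasurableSpace 𝒳]

/-- The number `a` is the last element of `N` among `1, ..., n` (`0` if there is none) and `b` is
the first element of `N` after `n`. -/
structure IsGap (N : ℕ → Prop) (n a b : ℕ) : Prop where
  le : a ≤ n
  lt : n < b
  right : N b
  left : 0 < a → N a
  between : ∀ u, a < u → u < b → ¬ N u

theorem IsGap.unique {N : ℕ → Prop} {n a b a' b' : ℕ} (h : IsGap N n a b)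
    (h' : IsGap N n a' b') : a = a' ∧ b = b' := by
  obtain ⟨h1, h2, h3, h4, h5⟩ := h
  obtain ⟨h1', h2', h3', h4', h5'⟩ := h'
  constructor
  · rcases lt_trichotomy a a' with hlt | heq | hlt
    · exact absurd (h4' (by omega)) (h5 _ hlt (by omega))
    · exact heq
    · exact absurd (h4 (by omega)) (h5' _ hlt (by omega))
  · rcases lt_trichotomy b b' with hlt | heq | hlt
    · exact absurd h3 (h5' _ (by omega) hlt)
    · exact heq
    · exact absurd h3' (h5 _ (by omega) hlt)

open Classical in
theorem isGap_find {N : ℕ → Prop} {n : ℕ} (h : ∃ b, n < b ∧ N b) :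
    IsGap N n (Nat.findGreatest (fun u => 0 < u ∧ N u) n) (Nat.find h) where
  le := Nat.findGreatest_le n
  lt := (Nat.find_spec h).1
  right := (Nat.find_spec h).2
  left := fun h0 => (Nat.findGreatest_of_ne_zero (P := fun u => 0 < u ∧ N u) rfl h0.ne').2
  between := fun u hu hub hN => by
    by_cases hun : u ≤ n
    · exact Nat.findGreatest_is_greatest hu hun ⟨by omega, hN⟩
    · exact Nat.find_min h hub ⟨by omega, hN⟩

/-- The value at index `o` of the selected maximizer for the piece of length `L` of `x` that follows
the first `a` observations. -/
def alignmentSegment (m : HMMModel K 𝒳) (l : Fin K) (ι : Fin K → ℝ) (x : ℕ → 𝒳) (a L o : ℕ) :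
    Fin K :=
  if h : o < L then revLexMax (m.constrainedAlignments ι l (fun j : Fin L => x (a + j))) ⟨o, h⟩
  else 0

theorem alignmentSegment_congr (m : HMMModel K 𝒳) (l : Fin K) (ι : Fin K → ℝ) {x x' : ℕ → 𝒳}
    {a a' L o : ℕ} (h : ∀ j < L, x (a + j) = x' (a' + j)) :
    alignmentSegment m l ι x a L o = alignmentSegment m l ι x' a' L o := by
  have : (fun j : Fin L => x (a + j)) = fun j : Fin L => x' (a' + j) := funext fun j => h j j.2
  simp only [alignmentSegment, this]

open Classical in
/-- The piecewise alignment of `x` with node times `N`: the initial distribution is `ι` for the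
piece that ends at the first node time, and `m.p l` for the later pieces. -/
def alignment (m : HMMModel K 𝒳) (l : Fin K) (ι : Fin K → ℝ) (N : ℕ → Prop) (x : ℕ → 𝒳) (n : ℕ) :
    Fin K :=
  if h : ∃ b, n < b ∧ N b then
    let b := Nat.find h
    let a := Nat.findGreatest (fun u => 0 < u ∧ N u) n
    alignmentSegment m l (if a = 0 then ι else m.p l) x a (b - a) (n - a)
  else 0

theorem infiniteAlignment_eq_alignment (m : HMMModel K 𝒳) (B : Set (Fin M → 𝒳)) (r : ℕ) (l : Fin K)
    (x : ℕ → 𝒳) : m.infiniteAlignment B r l x = alignment m l m.init (IsNodeTime B r x) x := by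
  classical
  funext n
  unfold HMMModel.infiniteAlignment alignment
  by_cases h : ∃ b, n < b ∧ IsNodeTime B r x b
  · rw [dif_pos h, dif_pos h, alignmentSegment, dif_pos]
  · rw [dif_neg h, dif_neg h]

theorem IsGap.alignment_eq {N : ℕ → Prop} {n a b : ℕ} (h : IsGap N n a b) (m : HMMModel K 𝒳)
    (l : Fin K) (ι : Fin K → ℝ) (x : ℕ → 𝒳) : alignment m l ι N x n =
      alignmentSegment m l (if a = 0 then ι else m.p l) x a (b - a) (n - a) := by
  classical
  have hex : ∃ b, n < b ∧ N b := ⟨b, h.lt, h.right⟩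
  obtain ⟨rfl, rfl⟩ := h.unique (isGap_find hex)
  rw [alignment, dif_pos hex]

/-- After a node time `t`, the alignment is that of the shifted sequence with initial distribution
`m.p l`. -/
theorem alignment_shift (m : HMMModel K 𝒳) (l : Fin K) (ι : Fin K → ℝ) {N N' : ℕ → Prop}
    (x : ℕ → 𝒳) {t : ℕ} (ht : 0 < t) (hNt : N t) (hN : ∀ u, 0 < u → (N' u ↔ N (t + u))) (n : ℕ) :
    alignment m l ι N x (t + n) = alignment m l (m.p l) N' (shift t x) n := by
  classical
  by_cases hex : ∃ b, n < b ∧ N' b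
  · have hg := isGap_find hex
    generalize Nat.find hex = b at hg
    generalize Nat.findGreatest (fun u => 0 < u ∧ N' u) n = a at hg
    obtain ⟨h1, h2, h3, h4, h5⟩ := hg
    have hg' : IsGap N (t + n) (t + a) (t + b) := by
      refine ⟨by omega, by omega, (hN b (by omega)).1 h3, fun _ => ?_, fun u hu hub => ?_⟩
      · rcases Nat.eq_zero_or_pos a with rfl | ha
        · exact hNt
        · exact (hN a ha).1 (h4 ha)
      · have := h5 (u - t) (by omega) (by omega)
        rwa [hN _ (by omega), Nat.add_sub_cancel' (by omega)] at this
    rw [hg'.alignment_eq, IsGap.alignment_eq ⟨h1, h2, h3, h4, h5⟩, if_neg (by omega), ite_self,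
      show t + b - (t + a) = b - a by omega, show t + n - (t + a) = n - a by omega]
    exact alignmentSegment_congr m l _ fun j _ => by rw [shift, add_assoc]
  · have hex' : ¬ ∃ b, t + n < b ∧ N b := by
      rintro ⟨b, hb, hNb⟩
      refine hex ⟨b - t, by omega, (hN _ (by omega)).2 ?_⟩
      rwa [Nat.add_sub_cancel' (by omega)]
    rw [alignment, alignment, dif_neg hex, dif_neg hex']

/-- Before a node time `t`, the alignment depends only on the node times up to `t` and on the first
`t` observations. -/
theorem alignment_congr (m : HMMModel K 𝒳) (l : Fin K) (ι : Fin K → ℝ) {N N' : ℕ → Prop}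
    {x x' : ℕ → 𝒳} {t n : ℕ} (hn : n < t) (hNt : N t) (hN : ∀ u ≤ t, N u ↔ N' u)
    (hx : ∀ j < t, x j = x' j) : alignment m l ι N x n = alignment m l ι N' x' n := by
  classical
  have hex : ∃ b, n < b ∧ N b := ⟨t, hn, hNt⟩
  have hg := isGap_find hex
  have hbt : Nat.find hex ≤ t := Nat.find_min' hex ⟨hn, hNt⟩
  generalize Nat.find hex = b at hg hbt
  generalize Nat.findGreatest (fun u => 0 < u ∧ N u) n = a at hg
  obtain ⟨h1, h2, h3, h4, h5⟩ := hg
  have hg' : IsGap N' n a b :=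
    ⟨h1, h2, (hN b hbt).1 h3, fun ha => (hN a (by omega)).1 (h4 ha),
      fun u hu hub => (not_congr (hN u (by omega))).1 (h5 u hu hub)⟩
  rw [hg'.alignment_eq, IsGap.alignment_eq ⟨h1, h2, h3, h4, h5⟩]
  exact alignmentSegment_congr m l _ fun j hj => hx _ (by omega)

end Alignment

/-! ### Measurability of the alignment -/

section AlignmentMeasurability

variable {K : ℕ} {𝒳 : Type*} [MeasurableSpace 𝒳]

theorem measurable_likelihood (m : HMMModel K 𝒳) (ι : Fin K → ℝ) {n : ℕ} (v : Fin n → Fin K) :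
    Measurable fun x : Fin n → 𝒳 => m.likelihood ι x v := by
  unfold HMMModel.likelihood
  refine measurable_const.mul (Finset.measurable_prod _ fun j _ => ?_)
  exact (m.f_measurable (v j)).comp (measurable_pi_apply j)

variable [NeZero K]

theorem measurable_revLexMax_constrainedAlignments (m : HMMModel K 𝒳) (ι : Fin K → ℝ) (l : Fin K)
    (n : ℕ) : Measurable fun x : Fin n → 𝒳 => revLexMax (m.constrainedAlignments ι l x) := by
  have h1 : Measurable fun x : Fin n → 𝒳 => m.constrainedAlignments ι l x := by
    refine measurable_set_iff.2 fun v => measurableSet_setOfPred.1 ?_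
    have : {x : Fin n → 𝒳 | v ∈ m.constrainedAlignments ι l x} =
        {_x | HMMModel.EndsAt l v} ∩ ⋂ w, ⋂ (_ : HMMModel.EndsAt l w),
          {x | m.likelihood ι x w ≤ m.likelihood ι x v} := by
      ext x
      simp [HMMModel.constrainedAlignments]
    rw [this]
    exact (MeasurableSet.const _).inter (MeasurableSet.iInter fun w => MeasurableSet.iInter fun _ =>
      measurableSet_le (measurable_likelihood m ι w) (measurable_likelihood m ι v))
  exact (measurable_of_countable (revLexMax (K := K) (n := n))).comp h1

theorem measurable_alignmentSegment (m : HMMModel K 𝒳) (l : Fin K) (ι : Fin K → ℝ) (a L o : ℕ) :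
    Measurable fun x : ℕ → 𝒳 => alignmentSegment m l ι x a L o := by
  by_cases h : o < L
  · simp only [alignmentSegment, dif_pos h]
    have h1 : Measurable fun (x : ℕ → 𝒳) (j : Fin L) => x (a + j) := by fun_prop
    exact (measurable_pi_apply _).comp
      ((measurable_revLexMax_constrainedAlignments m ι l L).comp h1)
  · simp only [alignmentSegment, dif_neg h]
    exact measurable_const

theorem measurable_alignment {α : Type*} [MeasurableSpace α] (m : HMMModel K 𝒳) (l : Fin K)
    (ι : Fin K → ℝ) {N : α → ℕ → Prop} {x : α → ℕ → 𝒳} (hN : ∀ u, MeasurableSet {a | N a u})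
    (hx : Measurable x) (n : ℕ) : Measurable fun c => alignment m l ι (N c) (x c) n := by
  classical
  have hgap : ∀ a b, MeasurableSet {c | IsGap (N c) n a b} := by
    intro a b
    have : {c | IsGap (N c) n a b} = {_c | a ≤ n} ∩ {_c | n < b} ∩ {c | N c b} ∩
        ({_c | 0 < a}ᶜ ∪ {c | N c a}) ∩
        ⋂ u, ⋂ (_ : a < u), ⋂ (_ : u < b), {c | N c u}ᶜ := by
      ext c
      simp only [Set.mem_inter_iff, Set.mem_ofPred_eq, Set.mem_union, Set.mem_compl_iff,
        Set.mem_iInter]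
      constructor
      · rintro ⟨h1, h2, h3, h4, h5⟩
        exact ⟨⟨⟨⟨h1, h2⟩, h3⟩, imp_iff_not_or.1 h4⟩, h5⟩
      · rintro ⟨⟨⟨⟨h1, h2⟩, h3⟩, h4⟩, h5⟩
        exact ⟨h1, h2, h3, imp_iff_not_or.2 h4, h5⟩
    rw [this]
    refine (((((MeasurableSet.const _).inter (MeasurableSet.const _)).inter (hN b)).inter
      ((MeasurableSet.const _).compl.union (hN a))).inter ?_)
    exact .iInter fun u => .iInter fun _ => .iInter fun _ => (hN u).compl
  refine measurable_to_countable' fun k => ?_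
  have : (fun c => alignment m l ι (N c) (x c) n) ⁻¹' {k} =
      (⋃ a, ⋃ b, {c | IsGap (N c) n a b} ∩ {c | alignmentSegment m l
        (if a = 0 then ι else m.p l) (x c) a (b - a) (n - a) = k}) ∪
      ((⋃ b, {_c | n < b} ∩ {c | N c b})ᶜ ∩ {_c | (0 : Fin K) = k}) := by
    ext c
    simp only [Set.mem_preimage, Set.mem_singleton_iff, Set.mem_union, Set.mem_iUnion,
      Set.mem_inter_iff, Set.mem_ofPred_eq, Set.mem_compl_iff]
    by_cases hex : ∃ b, n < b ∧ N c b
    · have hg := isGap_find hex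
      rw [hg.alignment_eq]
      constructor
      · exact fun H => Or.inl ⟨_, _, hg, H⟩
      · rintro (⟨a, b, hg', H⟩ | ⟨H, -⟩)
        · obtain ⟨rfl, rfl⟩ := hg'.unique hg
          exact H
        · exact absurd hex H
    · rw [alignment, dif_neg hex]
      constructor
      · exact fun H => Or.inr ⟨hex, H⟩
      · rintro (⟨a, b, hg', H⟩ | ⟨-, H⟩)
        · exact absurd ⟨b, hg'.lt, hg'.right⟩ hex
        · exact H
  rw [this]
  refine MeasurableSet.union (.iUnion fun a => .iUnion fun b => (hgap a b).inter ?_)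
    (.inter (MeasurableSet.iUnion fun b => .inter (.const _) (hN b)).compl (.const _))
  exact ((measurable_alignmentSegment m l _ a _ _).comp hx) (measurableSet_singleton k)

end AlignmentMeasurability

/-! ### Node times and separation -/

section Separation

variable {M : ℕ} {𝒳 : Type*} {B : Set (Fin M → 𝒳)} {r : ℕ}

/-- Two blocks in `B` start more than `r` places apart. -/
theorem IsSeparated.add_lt (hsep : IsSeparated B r) {x : ℕ → 𝒳} {k k' : ℕ}
    (hk : (fun j : Fin M => x (k + j)) ∈ B) (hk' : (fun j : Fin M => x (k' + j)) ∈ B)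
    (hlt : k < k') : k + r < k' := by
  by_contra hle
  refine hsep (k' - k) (by omega) (by omega) _ hk' _ (fun j hj => ?_) hk
  simp only
  congr 1
  omega

/-- A block in `B` that starts later than another one starts after the node of the latter. -/
theorem IsSeparated.add_sub_le (hsep : IsSeparated B r)
    (hfar : ∀ w, r < w → w + r < M → NoOverlapAt B w) {x : ℕ → 𝒳} {k k' : ℕ}
    (hk : (fun j : Fin M => x (k + j)) ∈ B) (hk' : (fun j : Fin M => x (k' + j)) ∈ B)
    (hlt : k < k') : k + (M - r) ≤ k' := by
  have := hsep.add_lt hk hk' hlt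
  by_contra hle
  refine hfar (k' - k) (by omega) (by omega) _ hk' _ (fun j hj => ?_) hk
  simp only
  congr 1
  omega

/-- The node times of `x` up to `t` that are visible in the first `t` observations, with `t` itself
declared to be one. -/
def IsNodeTimeUpTo (B : Set (Fin M → 𝒳)) (r t : ℕ) (x : ℕ → 𝒳) (u : ℕ) : Prop :=
  u = t ∨ ∃ k, u = k + (M - r) ∧ k + M ≤ t ∧ (fun j : Fin M => x (k + j)) ∈ B

/-- The node times after a node time `t` are those of the shifted sequence. -/
theorem isNodeTime_shift (hsep : IsSeparated B r)
    (hfar : ∀ w, r < w → w + r < M → NoOverlapAt B w) {x : ℕ → 𝒳} {t u : ℕ}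
    (ht : IsNodeTime B r x t) (hu : 0 < u) :
    IsNodeTime B r (shift t x) u ↔ IsNodeTime B r x (t + u) := by
  obtain ⟨k₀, rfl, hk₀⟩ := ht
  constructor
  · rintro ⟨k, rfl, hk⟩
    exact ⟨k₀ + (M - r) + k, by omega, by simpa only [shift, ← add_assoc] using hk⟩
  · rintro ⟨k, hku, hk⟩
    have := hsep.add_sub_le hfar hk₀ hk (by omega)
    refine ⟨k - (k₀ + (M - r)), by omega, ?_⟩
    convert! hk using 2
    simp only [shift]
    congr 1
    omega

/-- The node times up to a node time `t` are visible in the first `t` observations. -/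
theorem isNodeTime_iff_upTo (hr : r < M) (hsep : IsSeparated B r) {x x' : ℕ → 𝒳} {t u : ℕ}
    (ht : IsNodeTime B r x t) (hx : ∀ j < t, x j = x' j) (hu : u ≤ t) :
    IsNodeTime B r x u ↔ IsNodeTimeUpTo B r t x' u := by
  have hblock : ∀ k, k + M ≤ t →
      (fun j : Fin M => x (k + j)) = fun j : Fin M => x' (k + j) := fun k hk =>
    funext fun j => hx _ (by omega)
  constructor
  · rintro ⟨k, rfl, hk⟩
    obtain ⟨k₀, rfl, hk₀⟩ := ht
    rcases hu.eq_or_lt with hu | hu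
    · exact Or.inl hu
    · have := hsep.add_lt hk hk₀ (by omega)
      refine Or.inr ⟨k, rfl, by omega, ?_⟩
      rwa [← hblock k (by omega)]
  · rintro (rfl | ⟨k, rfl, hkt, hk⟩)
    · exact ht
    · exact ⟨k, rfl, by rwa [hblock k hkt]⟩

variable [MeasurableSpace 𝒳]

theorem measurableSet_isNodeTime (hB : MeasurableSet B) (r u : ℕ) :
    MeasurableSet {x : ℕ → 𝒳 | IsNodeTime B r x u} := by
  have : {x : ℕ → 𝒳 | IsNodeTime B r x u} = ⋃ k, {_x | u = k + (M - r)} ∩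
      (fun (x : ℕ → 𝒳) (j : Fin M) => x (k + j)) ⁻¹' B := by
    ext x; simp [IsNodeTime]
  rw [this]
  refine .iUnion fun k => .inter (.const _) ?_
  have h1 : Measurable fun (x : ℕ → 𝒳) (j : Fin M) => x (k + j) := by fun_prop
  exact h1 hB

theorem measurableSet_isNodeTimeUpTo (hB : MeasurableSet B) (r t u : ℕ) :
    MeasurableSet {x : ℕ → 𝒳 | IsNodeTimeUpTo B r t x u} := by
  have : {x : ℕ → 𝒳 | IsNodeTimeUpTo B r t x u} = {_x | u = t} ∪ ⋃ k, {_x | u = k + (M - r)} ∩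
      ({_x | k + M ≤ t} ∩ (fun (x : ℕ → 𝒳) (j : Fin M) => x (k + j)) ⁻¹' B) := by
    ext x; simp [IsNodeTimeUpTo]
  rw [this]
  refine .union (.const _) (.iUnion fun k => .inter (.const _) (.inter (.const _) ?_))
  have h1 : Measurable fun (x : ℕ → 𝒳) (j : Fin M) => x (k + j) := by fun_prop
  exact h1 hB

end Separation

/-! ### A criterion for independence at a random time -/

section Core

variable {Ω α β : Type*} [MeasurableSpace Ω] [MeasurableSpace α] [MeasurableSpace β]
  {P : Measure Ω}

theorem measurable_eval_time {E : Type*} [MeasurableSpace E] {W : ℕ → Ω → E} {T : Ω → ℕ}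
    (hW : ∀ n, Measurable (W n)) (hT : Measurable T) : Measurable fun ω => W (T ω) ω :=
  (measurable_from_prod_countable_right (f := fun x : ℕ × Ω => W x.1 x.2) hW).comp
    (hT.prodMk measurable_id)

/-- If, on each event `T = t`, the joint distribution of `U` and `Φ` is the product of a factor
depending on `t` and `U` by a factor depending on `Φ` only, then `U` and `Φ` are independent and the
latter factor is proportional to the law of `Φ`. -/
theorem indep_of_factor_on_times [IsProbabilityMeasure P] {U : Ω → α} {Φ : Ω → β} {T : Ω → ℕ}
    (hU : Measurable U) (hΦ : Measurable Φ) (hT : Measurable T) {a : ℕ → Set α → ENNReal}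
    {b : Set β → ENNReal}
    (H : ∀ t C F, MeasurableSet C → MeasurableSet F →
      P {ω | T ω = t ∧ U ω ∈ C ∧ Φ ω ∈ F} = a t C * b F) :
    IndepFun U Φ P ∧ ∀ F, MeasurableSet F → P (Φ ⁻¹' F) = (b Set.univ)⁻¹ * b F := by
  have hsum : ∀ C F, MeasurableSet C → MeasurableSet F →
      P (U ⁻¹' C ∩ Φ ⁻¹' F) = (∑' t, a t C) * b F := by
    intro C F hC hF
    rw [← ENNReal.tsum_mul_right]
    simp only [← H _ C F hC hF]
    rw [← measure_iUnion]
    · congr 1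
      ext ω
      simp
    · intro s t hst
      exact Set.disjoint_left.2 fun ω h1 h2 => hst (h1.1.symm.trans h2.1)
    · exact fun t => (hT (measurableSet_singleton t)).inter ((hU hC).inter (hΦ hF))
  have h1 : (∑' t, a t Set.univ) * b Set.univ = 1 := by
    rw [← hsum _ _ .univ .univ]
    simp
  have hΦF : ∀ F, MeasurableSet F → P (Φ ⁻¹' F) = (∑' t, a t Set.univ) * b F := fun F hF => by
    rw [← hsum _ _ .univ hF, Set.preimage_univ, Set.univ_inter]
  constructor
  · rw [indepFun_iff_measure_inter_preimage_eq_mul]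
    intro C F hC hF
    have hUC : P (U ⁻¹' C) = (∑' t, a t C) * b Set.univ := by
      rw [← hsum _ _ hC .univ, Set.preimage_univ, Set.inter_univ]
    rw [hsum C F hC hF, hUC, hΦF F hF]
    calc (∑' t, a t C) * b F = (∑' t, a t C) * b F * 1 := (mul_one _).symm
      _ = _ := by rw [← h1]; ring
  · intro F hF
    rw [hΦF F hF, ENNReal.eq_inv_of_mul_eq_one_left h1]

theorem IsRegenerative.map {E E' : Type*} [MeasurableSpace E] [MeasurableSpace E']
    {W : ℕ → Ω → E} {τ : ℕ → Ω → ℕ} (h : IsRegenerative P W τ) {f : E → E'} (hf : Measurable f) :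
    IsRegenerative P (fun n ω => f (W n ω)) τ where
  increasing := h.increasing
  indep i := by
    have h1 : Measurable (Prod.map id fun (s : ℕ → E) n => f (s n) :
      (Fin (i + 1) → ℕ) × (ℕ → E) → (Fin (i + 1) → ℕ) × (ℕ → E')) := by fun_prop
    have h2 : Measurable (Prod.map id fun (s : ℕ → E) n => f (s n) :
      (ℕ → ℕ) × (ℕ → E) → (ℕ → ℕ) × (ℕ → E')) := by fun_prop
    exact (h.indep i).comp h1 h2
  ident i := by
    have h2 : Measurable (Prod.map id fun (s : ℕ → E) n => f (s n) :
      (ℕ → ℕ) × (ℕ → E) → (ℕ → ℕ) × (ℕ → E')) := by fun_prop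
    exact (h.ident i).comp h2

end Core

/-! ### Splitting the data at a regeneration time -/

section Regeneration

variable {K M : ℕ} {𝒳 : Type*} {r : ℕ} {l : Fin K} {B' : Fin M → Set 𝒳}
  {B : Set (Fin M → 𝒳)} {q : Fin M → Fin K}

/-- The observations in a sequence of state-observation pairs. -/
def obsSeq (z : ℕ → Fin K × 𝒳) : ℕ → 𝒳 := fun n => (z n).2

theorem IsGood.lt_of_lt (hsep : IsSeparated B r) {z : ℕ → Fin K × 𝒳} {k k' : ℕ}
    (hk : IsGood B q z k) (hk' : IsGood B q z k') (hlt : k < k') : k + r < k' :=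
  hsep.add_lt (x := obsSeq z) hk.1 hk'.1 hlt

/-- A block of observations in `B`, emitted along `q`, starts right after the first `k` values of
`z` and is complete within the first `t` values. -/
def IsGoodUpTo (B : Set (Fin M → 𝒳)) (q : Fin M → Fin K) (t : ℕ) (z : ℕ → Fin K × 𝒳) (k : ℕ) :
    Prop :=
  k + M ≤ t ∧ IsGood B q z k

theorem isGoodUpTo_freeze {t : ℕ} {z : ℕ → Fin K × 𝒳} {k : ℕ} :
    IsGoodUpTo B q t (freeze t z) k ↔ IsGoodUpTo B q t z k :=
  and_congr_right fun hk => isGood_congr fun j hj => freeze_apply_of_lt z (by omega)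

open Classical in
/-- The part of the event `τ_i = t` that concerns the first `t` pairs: a barrier emitted along `q`
has its node at `t`, as far as this can be seen up to time `t`, and exactly `i` such barriers are
complete before. -/
def pastEvent (r : ℕ) (B' : Fin M → Set 𝒳) (B : Set (Fin M → 𝒳)) (q : Fin M → Fin K) (i t : ℕ) :
    Set (ℕ → Fin K × 𝒳) :=
  {z | ∃ k, t = k + (M - r) ∧
    (∀ j : Fin M, (j : ℕ) < M - r → (z (k + j)).2 ∈ B' j ∧ (z (k + j)).1 = q j) ∧
    Nat.count (IsGoodUpTo B q t z) k = i}

/-- The part of the event `τ_i = t` that concerns the pairs after time `t`: the last `r` pairs of the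
barrier. -/
def futureEvent (r : ℕ) (B' : Fin M → Set 𝒳) (q : Fin M → Fin K) : Set (ℕ → Fin K × 𝒳) :=
  {z | ∀ j : Fin M, M - r ≤ (j : ℕ) → (z (j - (M - r))).2 ∈ B' j ∧ (z (j - (M - r))).1 = q j}

theorem isGood_iff_head_tail (hB : B = Set.univ.pi B') {z : ℕ → Fin K × 𝒳} {k t : ℕ}
    (ht : t = k + (M - r)) :
    IsGood B q z k ↔
      (∀ j : Fin M, (j : ℕ) < M - r → (z (k + j)).2 ∈ B' j ∧ (z (k + j)).1 = q j) ∧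
        shift t z ∈ futureEvent r B' q := by
  have hidx : ∀ j : Fin M, M - r ≤ (j : ℕ) → k + (M - r) + ((j : ℕ) - (M - r)) = k + j :=
    fun j hj => by omega
  subst ht
  simp only [IsGood, hB, Set.mem_univ_pi, funext_iff, futureEvent, shift, Set.mem_ofPred_eq]
  constructor
  · rintro ⟨h1, h2⟩
    exact ⟨fun j _ => ⟨h1 j, h2 j⟩, fun j hj => by rw [hidx j hj]; exact ⟨h1 j, h2 j⟩⟩
  · rintro ⟨h1, h2⟩
    have : ∀ j : Fin M, (z (k + j)).2 ∈ B' j ∧ (z (k + j)).1 = q j := fun j => by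
      rcases lt_or_ge (j : ℕ) (M - r) with hj | hj
      · exact h1 j hj
      · rw [← hidx j hj]; exact h2 j hj
    exact ⟨fun j => (this j).1, fun j => (this j).2⟩

/-- Separation makes the event `τ_i = t` split into a condition on the first `t` pairs and a
condition on the pairs after time `t`. -/
theorem nth_isGood_eq_iff (hr : r < M) (hB : B = Set.univ.pi B') (hsep : IsSeparated B r)
    {z : ℕ → Fin K × 𝒳} (hinf : {k | IsGood B q z k}.Infinite) {i t : ℕ} :
    Nat.nth (IsGood B q z) i + (M - r) = t ↔
      z ∈ pastEvent r B' B q i t ∧ shift t z ∈ futureEvent r B' q := by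
  classical
  have hcount : ∀ k, IsGood B q z k → t = k + (M - r) →
      Nat.count (IsGoodUpTo B q t z) k = Nat.count (IsGood B q z) k :=
    fun k hk hkt => Nat.count_congr_of_lt fun k' hk' =>
      ⟨fun h => h.2, fun h => ⟨by have := h.lt_of_lt hsep hk hk'; omega, h⟩⟩
  constructor
  · intro h
    obtain ⟨h1, h2⟩ := (Nat.nth_eq_iff_of_infinite hinf (i := i)).1 rfl
    have h3 := (isGood_iff_head_tail (r := r) hB h.symm).1 h1
    exact ⟨⟨_, h.symm, h3.1, (hcount _ h1 h.symm).trans h2⟩, h3.2⟩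
  · rintro ⟨⟨k, hkt, h1, h2⟩, h3⟩
    have h4 := (isGood_iff_head_tail (r := r) hB hkt).2 ⟨h1, h3⟩
    rw [(Nat.nth_eq_iff_of_infinite hinf).2 ⟨h4, (hcount k h4 hkt).symm.trans h2⟩, hkt]

theorem freeze_mem_pastEvent {z : ℕ → Fin K × 𝒳} {i t : ℕ} :
    freeze t z ∈ pastEvent r B' B q i t ↔ z ∈ pastEvent r B' B q i t := by
  classical
  unfold pastEvent
  refine exists_congr fun k => and_congr_right fun hk => ?_
  have h1 : ∀ j : Fin M, (j : ℕ) < M - r → freeze t z (k + j) = z (k + j) := fun j hj =>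
    freeze_apply_of_lt z (by omega)
  have h2 : IsGoodUpTo B q t (freeze t z) = IsGoodUpTo B q t z :=
    funext fun k' => propext isGoodUpTo_freeze
  refine and_congr (forall₂_congr fun j hj => by rw [h1 j hj]) ?_
  rw [h2]

theorem state_eq_of_mem_pastEvent (hr : r < M)
    (hq : ∀ j : Fin M, (j : ℕ) + 1 = M - r → q j = l) {z : ℕ → Fin K × 𝒳} {i t : ℕ}
    (hz : z ∈ pastEvent r B' B q i t) : 0 < t ∧ (z (t - 1)).1 = l := by
  obtain ⟨k, rfl, h1, -⟩ := hz
  have h2 := (h1 ⟨M - r - 1, by omega⟩ (by simp only; omega)).2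
  rw [hq _ (by simp only; omega)] at h2
  refine ⟨by omega, ?_⟩
  rw [← h2]
  congr 2
  simp only
  omega

theorem isNodeTime_of_isGood {z : ℕ → Fin K × 𝒳} {k t : ℕ} (hk : IsGood B q z k)
    (ht : k + (M - r) = t) : IsNodeTime B r (obsSeq z) t :=
  ⟨k, ht.symm, hk.1⟩

variable [MeasurableSpace 𝒳]

theorem measurable_obsSeq : Measurable (obsSeq (K := K) (𝒳 := 𝒳)) :=
  measurable_pi_lambda _ fun n => (measurable_pi_apply n).snd

theorem measurableSet_isGoodUpTo (hB : MeasurableSet B) (q : Fin M → Fin K) (t k : ℕ) :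
    MeasurableSet {z : ℕ → Fin K × 𝒳 | IsGoodUpTo B q t z k} :=
  (MeasurableSet.const _).inter (measurableSet_isGood hB q k)

theorem measurableSet_pastEvent (hB' : ∀ j, MeasurableSet (B' j)) (hB : MeasurableSet B)
    (i t : ℕ) : MeasurableSet (pastEvent r B' B q i t) := by
  classical
  have : pastEvent r B' B q i t = ⋃ k, {_z | t = k + (M - r)} ∩
      ((⋂ j : Fin M, ⋂ (_ : (j : ℕ) < M - r), (fun z : ℕ → Fin K × 𝒳 => z (k + j)) ⁻¹'
        ({x | x.2 ∈ B' j} ∩ {x | x.1 = q j})) ∩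
      {z | Nat.count (IsGoodUpTo B q t z) k = i}) := by
    ext z
    simp only [pastEvent, Set.mem_ofPred_eq, Set.mem_iUnion, Set.mem_inter_iff, Set.mem_iInter,
      Set.mem_preimage]
  rw [this]
  refine .iUnion fun k => .inter (.const _) (.inter (.iInter fun j => .iInter fun _ => ?_) ?_)
  · exact measurable_pi_apply _ ((measurable_snd (hB' j)).inter
      (measurable_fst (measurableSet_singleton (q j))))
  · exact measurable_count_of_measurableSet
      (measurableSet_isGoodUpTo hB q t) k
      (measurableSet_singleton i)

theorem measurableSet_futureEvent (hB' : ∀ j, MeasurableSet (B' j)) :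
    MeasurableSet (futureEvent (K := K) r B' q) := by
  have : futureEvent r B' q = ⋂ j : Fin M, ⋂ (_ : M - r ≤ (j : ℕ)),
      (fun z : ℕ → Fin K × 𝒳 => z (j - (M - r))) ⁻¹' ({x | x.2 ∈ B' j} ∩ {x | x.1 = q j}) := by
    ext z
    simp [futureEvent]
  rw [this]
  exact .iInter fun j => .iInter fun _ => measurable_pi_apply _ ((measurable_snd (hB' j)).inter
    (measurable_fst (measurableSet_singleton (q j))))

variable [NeZero K]

/-- The regeneration times up to `t` and the frozen observation and alignment processes, read off
from the first `t` pairs, where `t` is the time `τ_i`. -/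
def pastData (m : HMMModel K 𝒳) (r : ℕ) (l : Fin K) (B : Set (Fin M → 𝒳)) (q : Fin M → Fin K)
    (i t : ℕ) (z : ℕ → Fin K × 𝒳) : (Fin (i + 1) → ℕ) × (ℕ → 𝒳 × Fin K) :=
  (fun j => Nat.nth (fun k => IsGoodUpTo B q t z k ∨ k + (M - r) = t) j + (M - r),
    fun n => (obsSeq z (min n (t - 1)),
      alignment m l m.init (IsNodeTimeUpTo B r t (obsSeq z)) (obsSeq z) (min n (t - 1))))

/-- The regeneration times counted from a regeneration time and the observation and alignment
processes after it, read off from the later pairs. -/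
def futureData (m : HMMModel K 𝒳) (r : ℕ) (l : Fin K) (B : Set (Fin M → 𝒳)) (q : Fin M → Fin K)
    (z : ℕ → Fin K × 𝒳) : (ℕ → ℕ) × (ℕ → 𝒳 × Fin K) :=
  (fun j => Nat.nth (IsGood B q z) j + (M - r),
    fun n => (obsSeq z n, alignment m l (m.p l) (IsNodeTime B r (obsSeq z)) (obsSeq z) n))

theorem measurable_pastData (m : HMMModel K 𝒳) (hB : MeasurableSet B) (i t : ℕ) :
    Measurable (pastData m r l B q i t) := by
  refine Measurable.prodMk (measurable_pi_lambda _ fun j => ?_) (measurable_pi_lambda _ fun n => ?_)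
  · refine (measurable_nth_of_measurableSet (fun k => ?_) _).add measurable_const
    exact (measurableSet_isGoodUpTo hB q t k).union (.const _)
  · exact ((measurable_pi_apply _).comp measurable_obsSeq).prodMk (measurable_alignment m l _
      (fun u => measurable_obsSeq (measurableSet_isNodeTimeUpTo hB r t u)) measurable_obsSeq _)

theorem measurable_futureData (m : HMMModel K 𝒳) (hB : MeasurableSet B) :
    Measurable (futureData m r l B q) := by
  refine Measurable.prodMk (measurable_pi_lambda _ fun j => ?_) (measurable_pi_lambda _ fun n => ?_)
  · exact (measurable_nth_of_measurableSet (measurableSet_isGood hB q) _).add measurable_const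
  · exact ((measurable_pi_apply _).comp measurable_obsSeq).prodMk (measurable_alignment m l _
      (fun u => measurable_obsSeq (measurableSet_isNodeTime hB r u)) measurable_obsSeq _)

theorem pastData_freeze (m : HMMModel K 𝒳) (hr : r < M) (hsep : IsSeparated B r)
    {z : ℕ → Fin K × 𝒳} (hinf : {k | IsGood B q z k}.Infinite) {i t : ℕ}
    (ht : Nat.nth (IsGood B q z) i + (M - r) = t) :
    pastData m r l B q i t (freeze t z) =
      (fun j : Fin (i + 1) => Nat.nth (IsGood B q z) j + (M - r),
        fun n => (obsSeq z (min n (t - 1)),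
          alignment m l m.init (IsNodeTime B r (obsSeq z)) (obsSeq z) (min n (t - 1)))) := by
  have hgood := Nat.nth_mem_of_infinite (p := IsGood B q z) hinf i
  have hnode := isNodeTime_of_isGood hgood ht
  have hobs : ∀ j < t, obsSeq z j = obsSeq (freeze t z) j := fun j hj => by
    simp only [obsSeq, freeze_apply_of_lt z hj]
  refine Prod.ext (funext fun j => ?_) (funext fun n => Prod.ext ?_ ?_)
  · simp only [pastData]
    congr 1
    refine Nat.nth_congr_of_le (p := IsGood B q z) hinf (Nat.lt_succ_iff.1 j.2) fun k hk => ?_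
    rcases hk.eq_or_lt with rfl | hk
    · exact ⟨fun _ => Or.inr ht, fun _ => hgood⟩
    · constructor
      · intro h
        have := h.lt_of_lt hsep hgood hk
        exact Or.inl (isGoodUpTo_freeze.2 ⟨by omega, h⟩)
      · rintro (h | h)
        · exact (isGoodUpTo_freeze.1 h).2
        · omega
  · exact (hobs _ (by omega)).symm
  · exact (alignment_congr m l m.init (by omega) hnode
      (fun u hu => isNodeTime_iff_upTo hr hsep hnode hobs hu) hobs).symm

theorem futureData_shift (m : HMMModel K 𝒳) (hr : r < M) (hsep : IsSeparated B r)
    (hfar : ∀ w, r < w → w + r < M → NoOverlapAt B w)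
    {z : ℕ → Fin K × 𝒳} (hinf : {k | IsGood B q z k}.Infinite) {i t : ℕ}
    (ht : Nat.nth (IsGood B q z) i + (M - r) = t) :
    futureData m r l B q (shift t z) =
      (fun j => Nat.nth (IsGood B q z) (i + 1 + j) + (M - r) - t,
        fun n => (obsSeq z (t + n),
          alignment m l m.init (IsNodeTime B r (obsSeq z)) (obsSeq z) (t + n))) := by
  have hgood := Nat.nth_mem_of_infinite (p := IsGood B q z) hinf i
  have hnode := isNodeTime_of_isGood hgood ht
  refine Prod.ext (funext fun j => ?_) (funext fun n => Prod.ext rfl ?_)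
  · have h1 := Nat.nth_add_of_gap (p := IsGood B q z) hinf (i := i) (t := t) rfl (by omega) (fun k' h1 h2 h3 => by
      have := hsep.add_sub_le hfar (x := obsSeq z) hgood.1 h3.1 h1
      omega) j
    have h2 : IsGood B q (shift t z) = fun n => IsGood B q z (t + n) :=
      funext fun n => propext isGood_shift
    simp only [futureData, h2]
    omega
  · exact (alignment_shift m l m.init (obsSeq z) (by omega) hnode
      (fun u hu => isNodeTime_shift hsep hfar hnode hu) n).symm

end Regeneration

/-! ### The hidden Markov model regenerates at the times `τ_i` -/

section HiddenMarkov

variable {K M : ℕ} {𝒳 Ω 𝓔 : Type*}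
    [MeasurableSpace 𝒳] [MeasurableSpace Ω] [MeasurableSpace 𝓔]
    {m : HMMModel K 𝒳} {P : Measure Ω}
    {Y : ℕ → Ω → Fin K} {e : ℕ → Ω → 𝓔} {h : Fin K × 𝓔 → 𝒳} {X : ℕ → Ω → 𝒳}
    {r : ℕ} {l : Fin K} {B' : Fin M → Set 𝒳} {B : Set (Fin M → 𝒳)} {q : Fin M → Fin K}

/-- The barrier of `τ_i` is complete at time `τ_i + r`, so the event `τ_i + r = n` is, up to a null
set, an event of the first `n` pairs. -/
theorem regenerationTime_stopping (hr : r < M) (hB : MeasurableSet B)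
    (hinf : ∀ᵐ ω ∂P, {k | IsGood B q (pairPath Y X ω) k}.Infinite) (i n : ℕ) :
    ∃ A : Set Ω,
      MeasurableSet[⨆ j : Fin n,
        MeasurableSpace.comap (fun ω => (Y j ω, X j ω)) inferInstance] A ∧
      {ω | regenerationTime B r q X Y i ω + r = n} =ᵐ[P] A := by
  classical
  by_cases hn : n < M
  · refine ⟨∅, @MeasurableSet.empty _ (_), ?_⟩
    have : {ω | regenerationTime B r q X Y i ω + r = n} = ∅ :=
      Set.eq_empty_of_forall_notMem fun ω (hω : regenerationTime B r q X Y i ω + r = n) => by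
        unfold regenerationTime at hω
        omega
    rw [this]
    exact Filter.EventuallyEq.rfl
  · let S : Set (ℕ → Fin K × 𝒳) := {z | IsGood B q z (n - M)} ∩
      {z | Nat.count (IsGood B q z) (n - M) = i}
    have hS : MeasurableSet S := (measurableSet_isGood hB q _).inter
      (measurable_count_of_measurableSet (measurableSet_isGood hB q) _ (measurableSet_singleton i))
    refine ⟨(fun ω => freeze n (pairPath Y X ω)) ⁻¹' S, ?_, ?_⟩
    · refine (@measurable_pi_lambda _ _ _ (_) _ _ fun k => ?_) hS
      exact Measurable.mono (comap_measurable fun ω => (Y (min k (n - 1)) ω, X (min k (n - 1)) ω))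
        (le_iSup_of_le (⟨min k (n - 1), by omega⟩ : Fin n) le_rfl) le_rfl
    · filter_upwards [hinf] with ω hω
      refine propext ?_
      have hfr : ∀ k ≤ n - M, IsGood B q (freeze n (pairPath Y X ω)) k ↔
          IsGood B q (pairPath Y X ω) k := fun k hk =>
        isGood_congr fun j hj => freeze_apply_of_lt _ (by omega)
      have h1 : Nat.nth (IsGood B q (pairPath Y X ω)) i = n - M ↔
          freeze n (pairPath Y X ω) ∈ S := by
        rw [Nat.nth_eq_iff_of_infinite hω]
        change _ ↔ IsGood B q (freeze n (pairPath Y X ω)) (n - M) ∧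
          Nat.count (IsGood B q (freeze n (pairPath Y X ω))) (n - M) = i
        rw [hfr _ le_rfl, Nat.count_congr_of_lt fun k hk => hfr k hk.le]
      refine Iff.trans ?_ h1
      change Nat.nth (IsGood B q (pairPath Y X ω)) i + (M - r) + r = n ↔ _
      omega

variable [NeZero K]

/-- On `τ_i = t`, the past and the future data are functions of the first `t` pairs and of the later
pairs, so that the Markov property at time `t`, where the state is `l`, factors their joint
distribution. -/
theorem IsHMM.measure_regeneration_factor [IsProbabilityMeasure P]
    (hX : IsHMM m P Y e h X) (hr : r < M)
    (hB' : ∀ j, MeasurableSet (B' j)) (hB : B = Set.univ.pi B') (hsep : IsSeparated B r)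
    (hfar : ∀ w, r < w → w + r < M → NoOverlapAt B w)
    (hq : ∀ j : Fin M, (j : ℕ) + 1 = M - r → q j = l)
    (hinf : ∀ᵐ ω ∂P, {k | IsGood B q (pairPath Y X ω) k}.Infinite) (i t : ℕ)
    {C : Set ((Fin (i + 1) → ℕ) × (ℕ → 𝒳 × Fin K))} {F : Set ((ℕ → ℕ) × (ℕ → 𝒳 × Fin K))}
    (hC : MeasurableSet C) (hF : MeasurableSet F) :
    P {ω | Nat.nth (IsGood B q (pairPath Y X ω)) i + (M - r) = t ∧
        (fun j : Fin (i + 1) => Nat.nth (IsGood B q (pairPath Y X ω)) j + (M - r),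
          fun n => (obsSeq (pairPath Y X ω) (min n (t - 1)),
            alignment m l m.init (IsNodeTime B r (obsSeq (pairPath Y X ω)))
              (obsSeq (pairPath Y X ω)) (min n (t - 1)))) ∈ C ∧
        (fun j => Nat.nth (IsGood B q (pairPath Y X ω)) (i + 1 + j) + (M - r) - t,
          fun n => (obsSeq (pairPath Y X ω) (t + n),
            alignment m l m.init (IsNodeTime B r (obsSeq (pairPath Y X ω)))
              (obsSeq (pairPath Y X ω)) (t + n))) ∈ F} =
      P {ω | Y (t - 1) ω = l ∧ freeze t (pairPath Y X ω) ∈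
          pastEvent r B' B q i t ∩ pastData m r l B q i t ⁻¹' C} *
        pairKernel P Y e h l (futureEvent r B' q ∩ futureData m r l B q ⁻¹' F) := by
  have hBm : MeasurableSet B := hB ▸ MeasurableSet.univ_pi hB'
  rcases Nat.eq_zero_or_pos t with rfl | ht
  · have h1 : {ω | Y (0 - 1) ω = l ∧ freeze 0 (pairPath Y X ω) ∈
        pastEvent r B' B q i 0 ∩ pastData m r l B q i 0 ⁻¹' C} = ∅ :=
      Set.eq_empty_of_forall_notMem fun ω hω =>
        (state_eq_of_mem_pastEvent hr hq hω.2.1).1.ne rfl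
    rw [h1, measure_empty, zero_mul]
    refine measure_mono_null (t := ∅) (fun ω hω => ?_) measure_empty
    have := hω.1
    omega
  obtain ⟨t, rfl⟩ : ∃ s, t = s + 1 := ⟨t - 1, by omega⟩
  rw [Nat.add_sub_cancel, ← hX.measure_past_inter_future t l
    ((measurableSet_pastEvent hB' hBm i (t + 1)).inter (measurable_pastData m hBm i (t + 1) hC))
    ((measurableSet_futureEvent hB').inter (measurable_futureData m hBm hF))]
  refine measure_congr ?_
  filter_upwards [hinf] with ω hω
  refine propext ?_
  have hsplit := nth_isGood_eq_iff hr hB hsep hω (i := i) (t := t + 1)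
  change _ ∧ _ ∧ _ ↔ _ ∧ (_ ∧ _) ∧ _ ∧ _
  rw [freeze_mem_pastEvent, Set.mem_preimage, Set.mem_preimage]
  constructor
  · rintro ⟨h1, h2, h3⟩
    obtain ⟨h4, h5⟩ := hsplit.1 h1
    rw [pastData_freeze m hr hsep hω h1, futureData_shift m hr hsep hfar hω h1]
    exact ⟨(state_eq_of_mem_pastEvent hr hq h4).2, ⟨h4, h2⟩, h5, h3⟩
  · rintro ⟨-, ⟨h4, h2⟩, h5, h3⟩
    have h1 := hsplit.2 ⟨h4, h5⟩
    rw [pastData_freeze m hr hsep hω h1] at h2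
    rw [futureData_shift m hr hsep hfar hω h1] at h3
    exact ⟨h1, h2, h3⟩

theorem IsHMM.isRegenerative_pair [IsProbabilityMeasure P]
    (hX : IsHMM m P Y e h X) (hr : r < M)
    (hB' : ∀ j, MeasurableSet (B' j)) (hB : B = Set.univ.pi B') (hsep : IsSeparated B r)
    (hfar : ∀ w, r < w → w + r < M → NoOverlapAt B w)
    (hq : ∀ j : Fin M, (j : ℕ) + 1 = M - r → q j = l)
    (hinf : ∀ᵐ ω ∂P, {k | IsGood B q (pairPath Y X ω) k}.Infinite) :
    IsRegenerative P
      (fun n ω => (X n ω, m.infiniteAlignment B r l (fun k => X k ω) n))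
      (regenerationTime B r q X Y) := by
  have hBm : MeasurableSet B := hB ▸ MeasurableSet.univ_pi hB'
  have hτm : ∀ i, Measurable (regenerationTime B r q X Y i) := fun i =>
    ((measurable_nth_of_measurableSet (measurableSet_isGood hBm q) i).comp
      hX.measurable_pairPath).add measurable_const
  have hWm : ∀ n, Measurable fun ω => (X n ω, m.infiniteAlignment B r l (fun k => X k ω) n) := by
    intro n
    simp only [infiniteAlignment_eq_alignment]
    have hp : Measurable fun (ω : Ω) (k : ℕ) => X k ω := measurable_pi_lambda _ hX.measurable_X
    exact (hX.measurable_X n).prodMk (measurable_alignment m l _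
      (fun u => hp (measurableSet_isNodeTime hBm r u)) hp n)
  have hΦm : ∀ i, Measurable fun ω =>
      ((fun j : ℕ => regenerationTime B r q X Y (i + 1 + j) ω - regenerationTime B r q X Y i ω),
        (fun n : ℕ => (X (regenerationTime B r q X Y i ω + n) ω, m.infiniteAlignment B r l
          (fun k => X k ω) (regenerationTime B r q X Y i ω + n)))) := fun i =>
    (measurable_pi_lambda _ fun j => (hτm _).sub (hτm i)).prodMk
      (measurable_pi_lambda _ fun n => measurable_eval_time hWm ((hτm i).add measurable_const))
  have hUm : ∀ i, Measurable fun ω =>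
      ((fun j : Fin (i + 1) => regenerationTime B r q X Y j ω),
        (fun n : ℕ => (X (min n (regenerationTime B r q X Y i ω - 1)) ω, m.infiniteAlignment B r l
          (fun k => X k ω) (min n (regenerationTime B r q X Y i ω - 1))))) := fun i =>
    (measurable_pi_lambda _ fun j => hτm _).prodMk
      (measurable_pi_lambda _ fun n => measurable_eval_time hWm
        (measurable_const.min ((hτm i).sub measurable_const)))
  have hcore := fun i => indep_of_factor_on_times (hUm i) (hΦm i) (hτm i)
    (a := fun t C => P {ω | Y (t - 1) ω = l ∧ freeze t (pairPath Y X ω) ∈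
          pastEvent r B' B q i t ∩ pastData m r l B q i t ⁻¹' C})
    (b := fun F => pairKernel P Y e h l (futureEvent r B' q ∩ futureData m r l B q ⁻¹' F))
    (fun t C F hC hF => by
      rw [← hX.measure_regeneration_factor hr hB' hB hsep hfar hq hinf i t hC hF]
      congr 1
      ext ω
      simp only [infiniteAlignment_eq_alignment]
      refine and_congr_right fun ht => ?_
      rw [ht]
      rfl)
  refine ⟨?_, fun i => (hcore i).1, fun i => ⟨(hΦm i).aemeasurable, (hΦm 0).aemeasurable, ?_⟩⟩
  · filter_upwards [hinf] with ω hω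
    refine ⟨by unfold regenerationTime; omega, fun i => ?_⟩
    exact Nat.add_lt_add_right (Nat.nth_strictMono (p := IsGood B q (pairPath Y X ω)) hω
      (Nat.lt_succ_self i)) _
  · refine Measure.ext fun F hF => ?_
    rw [Measure.map_apply (hΦm i) hF, Measure.map_apply (hΦm 0) hF, (hcore i).2 F hF,
      (hcore 0).2 F hF]

/-- The alignment between two consecutive regeneration times is a fixed measurable function of the
observations in between. -/
theorem exists_alignment_coding (X : ℕ → Ω → 𝒳) (Y : ℕ → Ω → Fin K) (m : HMMModel K 𝒳)
    (l : Fin K) (hr : r < M) (hB : MeasurableSet B)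
    (hsep : IsSeparated B r) (hfar : ∀ w, r < w → w + r < M → NoOverlapAt B w)
    (hinf : ∀ᵐ ω ∂P, {k | IsGood B q (pairPath Y X ω) k}.Infinite) :
    ∃ g : ∀ n : ℕ, (Fin n → 𝒳) → (Fin n → Fin K), (∀ n, Measurable (g n)) ∧
      ∀ᵐ ω ∂P, ∀ i : ℕ,
        (fun j : Fin (regenerationTime B r q X Y (i + 1) ω - regenerationTime B r q X Y i ω) =>
          m.infiniteAlignment B r l (fun k => X k ω) (regenerationTime B r q X Y i ω + j)) =
          g (regenerationTime B r q X Y (i + 1) ω - regenerationTime B r q X Y i ω)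
            (fun j => X (regenerationTime B r q X Y i ω + j) ω) := by
  -- a word is extended to a sequence by repeating its last letter; the end of the word is
  -- declared to be a node time
  let ext : ∀ n : ℕ, Fin n → (Fin n → 𝒳) → ℕ → 𝒳 := fun n j w k =>
    w ⟨min k (n - 1), by have := j.2; omega⟩
  have hext : ∀ n j, Measurable (ext n j) := fun n j =>
    measurable_pi_lambda _ fun k => measurable_pi_apply _
  refine ⟨fun n w j => alignment m l (m.p l) (IsNodeTimeUpTo B r n (ext n j w)) (ext n j w) j,
    fun n => measurable_pi_lambda _ fun j => measurable_alignment m l _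
      (fun u => hext n j (measurableSet_isNodeTimeUpTo hB r n u)) (hext n j) _, ?_⟩
  filter_upwards [hinf] with ω hω i
  have hnode : ∀ i, IsNodeTime B r (fun k => X k ω) (regenerationTime B r q X Y i ω) := fun i =>
    isNodeTime_of_isGood
      (Nat.nth_mem_of_infinite (p := IsGood B q (pairPath Y X ω)) hω i) rfl
  have hpos : 0 < regenerationTime B r q X Y i ω := by unfold regenerationTime; omega
  have hlt : regenerationTime B r q X Y i ω < regenerationTime B r q X Y (i + 1) ω :=
    Nat.add_lt_add_right (Nat.nth_strictMono (p := IsGood B q (pairPath Y X ω)) hω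
      (Nat.lt_succ_self i)) _
  have h1 := hnode i
  have h2 := hnode (i + 1)
  generalize regenerationTime B r q X Y i ω = t at *
  generalize regenerationTime B r q X Y (i + 1) ω = t' at *
  have h3 : IsNodeTime B r (shift t fun k => X k ω) (t' - t) := by
    rw [isNodeTime_shift hsep hfar h1 (by omega), Nat.add_sub_cancel' hlt.le]
    exact h2
  funext j
  rw [infiniteAlignment_eq_alignment, alignment_shift m l m.init _ hpos h1
    (fun u hu => isNodeTime_shift hsep hfar h1 hu) j]
  have hobs : ∀ k < t' - t, shift t (fun k => X k ω) k =
      ext (t' - t) j (fun j => X (t + j) ω) k := fun k hk => by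
    simp only [shift, ext]
    rw [min_eq_left (by omega)]
  exact alignment_congr m l (m.p l) j.2 h3
    (fun u hu => isNodeTime_iff_upTo hr hsep h3 hobs hu) hobs

end HiddenMarkov

end

theorem mainTheorem4 {K M : ℕ} [NeZero K] {𝒳 Ω 𝓔 : Type*}
    [MeasurableSpace 𝒳] [MeasurableSpace Ω] [MeasurableSpace 𝓔]
    (m : HMMModel K 𝒳) (P : Measure Ω) [IsProbabilityMeasure P]
    (Y : ℕ → Ω → Fin K) (e : ℕ → Ω → 𝓔) (h : Fin K × 𝓔 → 𝒳) (X : ℕ → Ω → 𝒳)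
    (hX : IsHMM m P Y e h X)
    -- the set of separated barriers `B = B_1 × ... × B_M` and the special state path `q`
    (r : ℕ) (hr : r < M) (l : Fin K) (B' : Fin M → Set 𝒳) (B : Set (Fin M → 𝒳))
    (hB' : ∀ j, MeasurableSet (B' j)) (hB : B = Set.univ.pi B')
    (hbar : ∀ b ∈ B, m.IsBarrier r l b)
    (hsep : IsSeparated B r)
    (hfar : ∀ w, r < w → w + r < M → NoOverlapAt B w)
    (q : Fin M → Fin K) (hq : ∀ j : Fin M, (j : ℕ) + 1 = M - r → q j = l)
    (hqpos : 0 < P {ω | (fun j : Fin M => Y j ω) = q})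
    (hBpos : 0 < P[{ω | (fun j : Fin M => X j ω) ∈ B} | {ω | (fun j : Fin M => Y j ω) = q}])
    -- the regeneration times and the alignment process
    (τ : ℕ → Ω → ℕ) (hτ : τ = regenerationTime B r q X Y)
    (V : ℕ → Ω → Fin K)
    (hV : V = fun n ω => m.infiniteAlignment B r l (fun k => X k ω) n) :
    -- the times are stopping times, the barrier of `τ i` being complete at time `τ i + r`
    (∀ i n : ℕ, ∃ A : Set Ω,
      MeasurableSet[⨆ j : Fin n,
        MeasurableSpace.comap (fun ω => (Y j ω, X j ω)) inferInstance] A ∧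
      {ω | τ i ω + r = n} =ᵐ[P] A) ∧
    IsRegenerative P X τ ∧
    IsRegenerative P V τ ∧
    IsRegenerative P (fun n ω => (X n ω, V n ω)) τ ∧
    ∃ g : ∀ n : ℕ, (Fin n → 𝒳) → (Fin n → Fin K), (∀ n, Measurable (g n)) ∧
      ∀ᵐ ω ∂P, ∀ i : ℕ,
        (fun j : Fin (τ (i + 1) ω - τ i ω) => V (τ i ω + j) ω) =
          g (τ (i + 1) ω - τ i ω) (fun j => X (τ i ω + j) ω) := by
  have hBm : MeasurableSet B := hB ▸ MeasurableSet.univ_pi hB'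
  have hqB : 0 < P {ω | IsGood B q (pairPath Y X ω) 0} := by
    refine pos_iff_ne_zero.2 fun h0 => hBpos.ne' ?_
    have hqm : MeasurableSet {ω | (fun j : Fin M => Y j ω) = q} := by
      have : Measurable fun (ω : Ω) (j : Fin M) => Y j ω :=
        measurable_pi_lambda _ fun j => hX.measurable_Y j
      exact this (measurableSet_singleton q)
    rw [cond_apply hqm]
    refine mul_eq_zero_of_right _ (measure_mono_null (fun ω hω => ?_) h0)
    simpa only [Set.mem_ofPred_eq, IsGood, zero_add, pairPath] using And.intro hω.2 hω.1
  have hinf := hX.ae_infinite_isGood (by omega) hBm hqB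
  have hpair := hX.isRegenerative_pair hr hB' hB hsep hfar hq hinf
  subst hτ hV
  exact ⟨regenerationTime_stopping hr hBm hinf, hpair.map measurable_fst,
    hpair.map measurable_snd, hpair,
    exists_alignment_coding X Y m l hr hBm hsep hfar hinf⟩
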